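/- Let $G$ be a finite simple graph with $n$ vertices and let $K\subseteq V(G)$ be a set of terminals of arbitrary size $k=|K|$. The problem $k$-in-a-tree asks whether there is a set $S$ with $K\subseteq S\subseteq V(G)$ such that the induced subgraph $G[S]$ is a tree. A cluster graph is a graph each of whose connected components is a clique, and a co-cluster graph is the complement of a cluster graph. The distance to co-cluster of $G$ is the smallest size $q$ of a set $U\subseteq V(G)$ such that $G\setminus U$ is a co-cluster graph. Theorem. There is a single algorithm that, given only $(G,K)$, correctly decides $k$-in-a-tree and runs in time $2^{O(q)}n^{O(1)}$, where $q$ is the distance to co-cluster of $G$. Precisely, there are a fixed random access machine program (unit cost per instruction; addition and truncated subtraction of natural numbers, indirect addressing, branching and loops; the input being $n$, the adjacency matrix of $G$ and the indicator vector of $K$) and a constant $c\in\mathbb N$ such that on every instance $(G,K)$ the program halts with the correct answer after at most $c\cdot 2^{cq}\,(n+1)^{c}$ steps. -/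

import Mathlib

/-! ## Graphs -/

/-- A cluster graph: every connected component is a clique. -/
def IsClusterGraph {V : Type*} (G : SimpleGraph V) : Prop :=
  ∀ C : G.ConnectedComponent, G.IsClique C.supp

/-- A co-cluster graph: the complement of a cluster graph. -/
def IsCoclusterGraph {V : Type*} (G : SimpleGraph V) : Prop :=
  IsClusterGraph Gᶜ

/-- `U` is a co-cluster modulator of `G`: removing the vertices of `U` leaves a co-cluster graph. -/
def IsCoclusterModulator {V : Type*} (G : SimpleGraph V) (U : Finset V) : Prop :=
  IsCoclusterGraph (G.induce ((U : Set V)ᶜ))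

/-- The distance to co-cluster: the least size of a co-cluster modulator. -/
noncomputable def distToCocluster {V : Type*} (G : SimpleGraph V) : ℕ :=
  sInf {q : ℕ | ∃ U : Finset V, IsCoclusterModulator G U ∧ U.card = q}

/-- On a finite graph the minimum in the definition of the distance is attained. -/
theorem exists_modulator_card_eq_distToCocluster {V : Type*} [Fintype V] (G : SimpleGraph V) :
    ∃ U : Finset V, IsCoclusterModulator G U ∧ U.card = distToCocluster G := by
  refine Nat.sInf_mem (s := {q : ℕ | ∃ U : Finset V, IsCoclusterModulator G U ∧ U.card = q})
    ⟨Finset.univ.card, Finset.univ, ?_, rfl⟩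
  intro C x hx
  exact absurd (Finset.mem_coe.2 (Finset.mem_univ x.1)) x.2

/-- `(G, K)` is a positive instance of `k`-in-a-tree (`k = |K|`): some induced subgraph of `G` that
contains all the terminals in `K` is a tree. -/
def HasInducedTreeContaining {V : Type*} (G : SimpleGraph V) (K : Finset V) : Prop :=
  ∃ S : Set V, (K : Set V) ⊆ S ∧ (G.induce S).IsTree

/-! ## Random access machines

Programs act on registers and on unbounded arrays, all holding natural numbers; a program is a
finite object and so mentions only finitely many registers and arrays. The arithmetic operations
are addition and truncated subtraction, so that `t` steps lengthen a number by `O(t)` bits only,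
and unit-cost time is polynomially related to Turing machine time. -/

namespace RAM

/-- A memory: the contents of register `r` and of cell `i` of array `a`. -/
@[ext] structure Mem where
  reg : ℕ → ℕ
  arr : ℕ → ℕ → ℕ

/-- Write the value `v` to register `r`. -/
def Mem.setReg (s : Mem) (r v : ℕ) : Mem :=
  { s with reg := Function.update s.reg r v }

/-- Write the value `v` to cell `i` of array `a`. -/
def Mem.setArr (s : Mem) (a i v : ℕ) : Mem :=
  { s with arr := Function.update s.arr a (Function.update (s.arr a) i v) }

/-- Programs; `r`, `x`, `y` name registers, `a` names an array and `c` is a constant. -/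
inductive Prog : Type
  /-- do nothing -/
  | skip : Prog
  /-- `r := c` -/
  | const (r c : ℕ) : Prog
  /-- `r := x` -/
  | copy (r x : ℕ) : Prog
  /-- `r := x + y` -/
  | add (r x y : ℕ) : Prog
  /-- `r := max (x - y) 0` -/
  | sub (r x y : ℕ) : Prog
  /-- `r := a[x]` -/
  | load (r a x : ℕ) : Prog
  /-- `a[x] := y` -/
  | store (a x y : ℕ) : Prog
  /-- first `p`, then `q` -/
  | seq (p q : Prog) : Prog
  /-- if `x ≠ 0` then `p` else `q` -/
  | branch (x : ℕ) (p q : Prog) : Prog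
  /-- while `x ≠ 0` do `p` -/
  | loop (x : ℕ) (p : Prog) : Prog

/-- `Exec p s t s'`: started on the memory `s`, the program `p` halts after exactly `t` steps with
the memory `s'`. Every elementary instruction and every test of a register takes one step. -/
inductive Exec : Prog → Mem → ℕ → Mem → Prop
  | skip (s : Mem) : Exec .skip s 1 s
  | const (s : Mem) (r c : ℕ) : Exec (.const r c) s 1 (s.setReg r c)
  | copy (s : Mem) (r x : ℕ) : Exec (.copy r x) s 1 (s.setReg r (s.reg x))
  | add (s : Mem) (r x y : ℕ) : Exec (.add r x y) s 1 (s.setReg r (s.reg x + s.reg y))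
  | sub (s : Mem) (r x y : ℕ) : Exec (.sub r x y) s 1 (s.setReg r (s.reg x - s.reg y))
  | load (s : Mem) (r a x : ℕ) : Exec (.load r a x) s 1 (s.setReg r (s.arr a (s.reg x)))
  | store (s : Mem) (a x y : ℕ) : Exec (.store a x y) s 1 (s.setArr a (s.reg x) (s.reg y))
  | seq {p q : Prog} {s s' s'' : Mem} {t t' : ℕ} :
      Exec p s t s' → Exec q s' t' s'' → Exec (.seq p q) s (t + t') s''
  | branch_pos {x : ℕ} {p q : Prog} {s s' : Mem} {t : ℕ} :
      s.reg x ≠ 0 → Exec p s t s' → Exec (.branch x p q) s (t + 1) s'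
  | branch_zero {x : ℕ} {p q : Prog} {s s' : Mem} {t : ℕ} :
      s.reg x = 0 → Exec q s t s' → Exec (.branch x p q) s (t + 1) s'
  | loop_zero {x : ℕ} {p : Prog} {s : Mem} :
      s.reg x = 0 → Exec (.loop x p) s 1 s
  | loop_pos {x : ℕ} {p : Prog} {s s' s'' : Mem} {t t' : ℕ} :
      s.reg x ≠ 0 → Exec p s t s' → Exec (.loop x p) s' t' s'' →
        Exec (.loop x p) s (t + 1 + t') s''

/-- Execution is deterministic, so a halting program has one step count and one result. -/
theorem Exec.unique {p : Prog} {s s₁ s₂ : Mem} {t₁ t₂ : ℕ}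
    (h₁ : Exec p s t₁ s₁) (h₂ : Exec p s t₂ s₂) : t₁ = t₂ ∧ s₁ = s₂ := by
  induction h₁ generalizing t₂ s₂ with
  | seq _ _ ih ih' =>
    cases h₂ with
    | seq g g' =>
      obtain ⟨rfl, rfl⟩ := ih g
      obtain ⟨rfl, rfl⟩ := ih' g'
      exact ⟨rfl, rfl⟩
  | branch_pos hx _ ih =>
    cases h₂ with
    | branch_pos _ g => obtain ⟨rfl, rfl⟩ := ih g; exact ⟨rfl, rfl⟩
    | branch_zero hx' _ => exact absurd hx' hx
  | branch_zero hx _ ih =>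
    cases h₂ with
    | branch_pos hx' _ => exact absurd hx hx'
    | branch_zero _ g => obtain ⟨rfl, rfl⟩ := ih g; exact ⟨rfl, rfl⟩
  | loop_zero hx =>
    cases h₂ with
    | loop_zero _ => exact ⟨rfl, rfl⟩
    | loop_pos hx' _ _ => exact absurd hx hx'
  | loop_pos hx _ _ ih ih' =>
    cases h₂ with
    | loop_zero hx' => exact absurd hx' hx
    | loop_pos _ g g' =>
      obtain ⟨rfl, rfl⟩ := ih g
      obtain ⟨rfl, rfl⟩ := ih' g'
      exact ⟨rfl, rfl⟩
  | _ => cases h₂; exact ⟨rfl, rfl⟩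

open Classical in
/-- The memory that presents the instance `(G, K)`: the number `n` of vertices in register `0`, the
adjacency matrix of `G` row by row in array `0` (cell `i * n + j` for the pair `i, j`), the
indicator vector of `K` in array `1`, and zeros everywhere else. -/
noncomputable def instanceMem {n : ℕ} (G : SimpleGraph (Fin n)) (K : Finset (Fin n)) : Mem where
  reg := fun r => if r = 0 then n else 0
  arr := fun a m =>
    if a = 0 then
      if ∃ i j : Fin n, m = (i : ℕ) * n + (j : ℕ) ∧ G.Adj i j then 1 else 0
    else if a = 1 then
      if ∃ i ∈ K, m = (i : ℕ) then 1 else 0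
    else 0

end RAM

/-! Call three vertices that induce an edge and an isolated vertex a bad triple. Every co-cluster
modulator meets every bad triple, so a greedily built maximal family of disjoint bad triples covers
a set `U` of at most `3q` vertices (`card_selected_le`), and no bad triple avoids `U`
(`not_isBadTriple_of_notMem_selected`). Thus a modulator is found without knowing `q`.

Outside `U` the graph is complete multipartite, so an induced tree `S` has there, up to one vertex
`c`, only vertices of a single part, represented by some `p` (`exists_center`). Hence `S = B ∪ I`,
where `B` is `S ∩ U` together with `c`, and `I` lies in an independent pool determined by `c` and
`p`. There are at most `2 ^ #U * n ^ 2` choices of `(B, c, p)`. For each of them the terminals in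
the pool are forced, and further pool vertices must connect `B` without creating a cycle. A
connected graph is a tree once it has fewer edges than vertices, and a further pool vertex with `k`
neighbours in `B` adds `k - 1` to edges minus vertices. So one seeks the least total price of
connecting `B`, by dynamic programming over the subsets `X` of the base already connected to `c`
(`Grow`). A cheap enough derivation yields a tree (`hasInducedTreeContaining_of_grow`); conversely a
cut argument turns a tree into a derivation that pays for each of its vertices at most once
(`exists_grow_of_isTree`).

On the machine every stage is a number or a table given by a term with bounded sums. Such terms
compile to programs (`comp_spec`, `fill_spec`) whose time is polynomial in the loop bound in
register `1` (`exists_cost_le`). The table of partial trees has `4 ^ #U * n ^ 3` cells, so a loop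
bound polynomial in `2 ^ #U + n` suffices. -/

namespace RAM

/-! ### Terms with bounded sums and their compilation -/

/-- Terms over the registers and arrays; `sum x b` is the sum of `b` over all values of the
register `x` below the contents of register `1`. -/
inductive Tm : Type
  | var (x : ℕ) : Tm
  | const (c : ℕ) : Tm
  | add (e f : Tm) : Tm
  | sub (e f : Tm) : Tm
  | read (a : ℕ) (e : Tm) : Tm
  | ite (b e f : Tm) : Tm
  | sum (x : ℕ) (e : Tm) : Tm

namespace Tm

/-- The value of a term. -/
def eval : Tm → (ℕ → ℕ) → (ℕ → ℕ → ℕ) → ℕ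
  | var x, σ, _ => σ x
  | const c, _, _ => c
  | add e f, σ, A => e.eval σ A + f.eval σ A
  | sub e f, σ, A => e.eval σ A - f.eval σ A
  | read a e, σ, A => A a (e.eval σ A)
  | ite b e f, σ, A => if b.eval σ A ≠ 0 then e.eval σ A else f.eval σ A
  | sum x e, σ, A => ∑ i ∈ Finset.range (σ 1), e.eval (Function.update σ x i) A

/-- All registers named in the term are below `k`, and register `1` is not bound. -/
def WF (k : ℕ) : Tm → Prop
  | var x => x < k
  | const _ => True
  | add e f => e.WF k ∧ f.WF k
  | sub e f => e.WF k ∧ f.WF k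
  | read _ e => e.WF k
  | ite b e f => b.WF k ∧ e.WF k ∧ f.WF k
  | sum x e => x < k ∧ x ≠ 1 ∧ e.WF k

instance decidableWF (k : ℕ) : (e : Tm) → Decidable (e.WF k)
  | var x => inferInstanceAs (Decidable (x < k))
  | const _ => inferInstanceAs (Decidable True)
  | add e f => @instDecidableAnd _ _ (decidableWF k e) (decidableWF k f)
  | sub e f => @instDecidableAnd _ _ (decidableWF k e) (decidableWF k f)
  | read _ e => decidableWF k e
  | ite b e f => @instDecidableAnd _ _ (decidableWF k b)
      (@instDecidableAnd _ _ (decidableWF k e) (decidableWF k f))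
  | sum x e => @instDecidableAnd _ _ (inferInstanceAs (Decidable (x < k)))
      (@instDecidableAnd _ _ (inferInstanceAs (Decidable (x ≠ 1))) (decidableWF k e))

theorem WF.mono {k l : ℕ} (hkl : k ≤ l) {e : Tm} (h : e.WF k) : e.WF l := by
  induction e with
  | var x => exact lt_of_lt_of_le h hkl
  | const => trivial
  | add e f ihe ihf => exact ⟨ihe h.1, ihf h.2⟩
  | sub e f ihe ihf => exact ⟨ihe h.1, ihf h.2⟩
  | read a e ih => exact ih h
  | ite b e f ihb ihe ihf => exact ⟨ihb h.1, ihe h.2.1, ihf h.2.2⟩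
  | sum x e ih => exact ⟨lt_of_lt_of_le h.1 hkl, h.2.1, ih h.2.2⟩

/-- Scratch registers from `k` upward cannot influence the value, so subterms may be computed one
after another. Register `1` must be among those preserved because it bounds every sum. -/
theorem eval_congr {k : ℕ} (hk : 1 < k) {e : Tm} (h : e.WF k) {σ τ : ℕ → ℕ} {A : ℕ → ℕ → ℕ}
    (hστ : ∀ r < k, σ r = τ r) : e.eval σ A = e.eval τ A := by
  induction e generalizing σ τ with
  | var x => exact hστ x h
  | const => rfl
  | add e f ihe ihf => simp only [eval, ihe h.1 hστ, ihf h.2 hστ]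
  | sub e f ihe ihf => simp only [eval, ihe h.1 hστ, ihf h.2 hστ]
  | read a e ih => simp only [eval, ih h hστ]
  | ite b e f ihb ihe ihf => simp only [eval, ihb h.1 hστ, ihe h.2.1 hστ, ihf h.2.2 hστ]
  | sum x e ih =>
    simp only [eval, hστ 1 hk]
    refine Finset.sum_congr rfl fun i _ => ih h.2.2 fun r hr => ?_
    by_cases hx : r = x
    · subst hx; simp
    · simp [hx, hστ r hr]

/-- The program that computes a term into register `k`, with scratch registers above `k`. -/
def comp : Tm → ℕ → Prog
  | var x, k => .copy k x
  | const c, k => .const k c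
  | add e f, k => .seq (e.comp k) (.seq (f.comp (k + 1)) (.add k k (k + 1)))
  | sub e f, k => .seq (e.comp k) (.seq (f.comp (k + 1)) (.sub k k (k + 1)))
  | read a e, k => .seq (e.comp k) (.load k a k)
  | ite b e f, k => .seq (b.comp k) (.branch k (e.comp k) (f.comp k))
  | sum x e, k =>
    .seq (.copy k 1) (.seq (.copy (k + 1) x) (.seq (.const (k + 2) 0) (.seq (.const x 0)
      (.seq (.loop k (.seq (e.comp (k + 3)) (.seq (.add (k + 2) (k + 2) (k + 3))
        (.seq (.const (k + 3) 1) (.seq (.add x x (k + 3)) (.sub k k (k + 3)))))))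
      (.seq (.copy k (k + 2)) (.copy x (k + 1)))))))

/-- A bound on the running time of `comp`, where `L` is the content of register `1`. -/
def cost (L : ℕ) : Tm → ℕ
  | var _ => 1
  | const _ => 1
  | add e f => e.cost L + f.cost L + 1
  | sub e f => e.cost L + f.cost L + 1
  | read _ e => e.cost L + 1
  | ite b e f => b.cost L + e.cost L + f.cost L + 1
  | sum _ e => L * (e.cost L + 5) + 7

/-! ### Hoare-style rules with time bounds -/

/-- Running `p` from `s` takes at most `T` steps and ends in a memory satisfying `Q`. -/
def Runs (p : Prog) (s : Mem) (T : ℕ) (Q : Mem → Prop) : Prop :=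
  ∃ t s', Exec p s t s' ∧ t ≤ T ∧ Q s'

theorem Runs.seq {p q : Prog} {s : Mem} {T T' : ℕ} {Q Q' : Mem → Prop} (hp : Runs p s T Q)
    (hq : ∀ s', Q s' → Runs q s' T' Q') : Runs (.seq p q) s (T + T') Q' := by
  obtain ⟨t, s', h, ht, hQ⟩ := hp
  obtain ⟨t', s'', h', ht', hQ'⟩ := hq s' hQ
  exact ⟨_, _, .seq h h', by omega, hQ'⟩

theorem Runs.mono {p : Prog} {s : Mem} {T T' : ℕ} {Q Q' : Mem → Prop} (hp : Runs p s T Q)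
    (hT : T ≤ T') (hQ : ∀ s', Q s' → Q' s') : Runs p s T' Q' := by
  obtain ⟨t, s', h, ht, hQ'⟩ := hp
  exact ⟨t, s', h, ht.trans hT, hQ _ hQ'⟩

theorem Runs.copy {s : Mem} {r x : ℕ} {Q : Mem → Prop} (h : Q (s.setReg r (s.reg x))) :
    Runs (.copy r x) s 1 Q := ⟨_, _, .copy .., le_rfl, h⟩

theorem Runs.const {s : Mem} {r c : ℕ} {Q : Mem → Prop} (h : Q (s.setReg r c)) :
    Runs (.const r c) s 1 Q := ⟨_, _, .const .., le_rfl, h⟩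

theorem Runs.add {s : Mem} {r x y : ℕ} {Q : Mem → Prop}
    (h : Q (s.setReg r (s.reg x + s.reg y))) : Runs (.add r x y) s 1 Q :=
  ⟨_, _, .add .., le_rfl, h⟩

theorem Runs.sub {s : Mem} {r x y : ℕ} {Q : Mem → Prop}
    (h : Q (s.setReg r (s.reg x - s.reg y))) : Runs (.sub r x y) s 1 Q :=
  ⟨_, _, .sub .., le_rfl, h⟩

theorem Runs.load {s : Mem} {r a x : ℕ} {Q : Mem → Prop}
    (h : Q (s.setReg r (s.arr a (s.reg x)))) : Runs (.load r a x) s 1 Q :=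
  ⟨_, _, .load .., le_rfl, h⟩

theorem Runs.store {s : Mem} {a x y : ℕ} {Q : Mem → Prop}
    (h : Q (s.setArr a (s.reg x) (s.reg y))) : Runs (.store a x y) s 1 Q :=
  ⟨_, _, .store .., le_rfl, h⟩

theorem Runs.seq_copy {s : Mem} {r x T : ℕ} {q : Prog} {Q : Mem → Prop}
    (h : Runs q (s.setReg r (s.reg x)) T Q) : Runs (.seq (.copy r x) q) s (1 + T) Q :=
  (Runs.copy (Q := (· = s.setReg r (s.reg x))) rfl).seq fun _ hs => hs ▸ h

theorem Runs.seq_const {s : Mem} {r c T : ℕ} {q : Prog} {Q : Mem → Prop}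
    (h : Runs q (s.setReg r c) T Q) : Runs (.seq (.const r c) q) s (1 + T) Q :=
  (Runs.const (Q := (· = s.setReg r c)) rfl).seq fun _ hs => hs ▸ h

theorem Runs.seq_add {s : Mem} {r x y T : ℕ} {q : Prog} {Q : Mem → Prop}
    (h : Runs q (s.setReg r (s.reg x + s.reg y)) T Q) : Runs (.seq (.add r x y) q) s (1 + T) Q :=
  (Runs.add (Q := (· = s.setReg r (s.reg x + s.reg y))) rfl).seq fun _ hs => hs ▸ h

theorem Runs.seq_store {s : Mem} {a x y T : ℕ} {q : Prog} {Q : Mem → Prop}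
    (h : Runs q (s.setArr a (s.reg x) (s.reg y)) T Q) :
    Runs (.seq (.store a x y) q) s (1 + T) Q :=
  (Runs.store (Q := (· = s.setArr a (s.reg x) (s.reg y))) rfl).seq fun _ hs => hs ▸ h

/-- A loop that counts register `k` down to zero, with invariant `I` indexed by the number of
completed rounds. -/
theorem Runs.loop {k N T : ℕ} {p : Prog} {s : Mem} (I : ℕ → Mem → Prop)
    (h0 : s.reg k = N) (hI : I 0 s)
    (hp : ∀ i < N, ∀ s', I i s' → s'.reg k = N - i →
      Runs p s' T fun s'' => I (i + 1) s'' ∧ s''.reg k = N - (i + 1)) :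
    Runs (.loop k p) s (N * (T + 1) + 1) (I N) := by
  suffices H : ∀ j i s', i + j = N → I i s' → s'.reg k = j →
      Runs (.loop k p) s' (j * (T + 1) + 1) (I N) by
    simpa using H N 0 s (by omega) hI h0
  intro j
  induction j with
  | zero =>
    intro i s' hij hI' hk
    exact ⟨1, s', .loop_zero hk, by omega, by simpa [← hij] using hI'⟩
  | succ j ih =>
    intro i s' hij hI' hk
    obtain ⟨t, s'', h, ht, hI'', hk''⟩ := hp i (by omega) s' hI' (by omega)
    obtain ⟨t', s₃, h', ht', hQ⟩ := ih (i + 1) s'' (by omega) hI'' (by omega)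
    refine ⟨_, _, .loop_pos (by omega) h h', ?_, hQ⟩
    rw [Nat.succ_mul]; omega

/-- The postcondition of `comp`. -/
def Post (k : ℕ) (s : Mem) (v : ℕ) (s' : Mem) : Prop :=
  s'.arr = s.arr ∧ s'.reg k = v ∧ ∀ r < k, s'.reg r = s.reg r

theorem comp_spec (e : Tm) {k L : ℕ} (hk : 1 < k) (h : e.WF k) (s : Mem) (hL : s.reg 1 = L) :
    Runs (e.comp k) s (e.cost L) (Post k s (e.eval s.reg s.arr)) := by
  induction e generalizing k s with
  | var x => exact .copy ⟨rfl, by simp [Mem.setReg, eval], fun r hr => by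
      simp [Mem.setReg, hr.ne]⟩
  | const => exact .const ⟨rfl, by simp [Mem.setReg, eval], fun r hr => by
      simp [Mem.setReg, hr.ne]⟩
  | add e f ihe ihf =>
    refine (Runs.seq (T' := f.cost L + 1) (ihe hk h.1 s hL) fun s₁ ⟨ha₁, hv₁, hr₁⟩ => Runs.seq
      (ihf (k := k + 1) (by omega) (h.2.mono (by omega)) s₁ ((hr₁ 1 hk).trans hL))
      fun s₂ ⟨ha₂, hv₂, hr₂⟩ => Runs.add (Q := Post k s _) ⟨?_, ?_, ?_⟩).mono ?_ fun _ hs => hs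
    · simp [Mem.setReg, ha₁, ha₂]
    · simp [Mem.setReg, eval, hv₂, hr₂ k, hv₁, ha₁, eval_congr hk h.2 hr₁]
    · intro r hr
      simp [Mem.setReg, hr.ne, hr₂ r (by omega), hr₁ r hr]
    · simp only [cost]; omega
  | sub e f ihe ihf =>
    refine (Runs.seq (T' := f.cost L + 1) (ihe hk h.1 s hL) fun s₁ ⟨ha₁, hv₁, hr₁⟩ => Runs.seq
      (ihf (k := k + 1) (by omega) (h.2.mono (by omega)) s₁ ((hr₁ 1 hk).trans hL))
      fun s₂ ⟨ha₂, hv₂, hr₂⟩ => Runs.sub (Q := Post k s _) ⟨?_, ?_, ?_⟩).mono ?_ fun _ hs => hs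
    · simp [Mem.setReg, ha₁, ha₂]
    · simp [Mem.setReg, eval, hv₂, hr₂ k, hv₁, ha₁, eval_congr hk h.2 hr₁]
    · intro r hr
      simp [Mem.setReg, hr.ne, hr₂ r (by omega), hr₁ r hr]
    · simp only [cost]; omega
  | read a e ih =>
    refine Runs.seq (ih hk h s hL) fun s₁ ⟨ha₁, hv₁, hr₁⟩ => Runs.load ⟨?_, ?_, ?_⟩
    · simp [Mem.setReg, ha₁]
    · simp [Mem.setReg, eval, ha₁, hv₁]
    · intro r hr
      simp [Mem.setReg, hr.ne, hr₁ r hr]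
  | ite b e f ihb ihe ihf =>
    refine (Runs.seq (T' := e.cost L + f.cost L + 1) (Q' := Post k s _)
      (ihb hk h.1 s hL) fun s₁ ⟨ha₁, hv₁, hr₁⟩ => ?_).mono ?_ fun _ hs => hs
    · have hL₁ := (hr₁ 1 hk).trans hL
      by_cases hb : b.eval s.reg s.arr = 0
      · obtain ⟨t, s₂, hx, ht, ha₂, hv₂, hr₂⟩ := ihf hk h.2.2 s₁ hL₁
        refine ⟨_, _, .branch_zero (by omega) hx, by omega, ha₂.trans ha₁, ?_, fun r hr =>
          (hr₂ r hr).trans (hr₁ r hr)⟩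
        simp [eval, hb, hv₂, ha₁, eval_congr hk h.2.2 hr₁]
      · obtain ⟨t, s₂, hx, ht, ha₂, hv₂, hr₂⟩ := ihe hk h.2.1 s₁ hL₁
        refine ⟨_, _, .branch_pos (by omega) hx, by omega, ha₂.trans ha₁, ?_, fun r hr =>
          (hr₂ r hr).trans (hr₁ r hr)⟩
        simp [eval, hb, hv₂, ha₁, eval_congr hk h.2.1 hr₁]
    · simp only [cost]; omega
  | sum x e ih =>
    obtain ⟨hx, hx1, he⟩ := h
    set σ := s.reg with hσ
    -- Register `k` counts down, `k + 1` keeps the old content of the summation register `x`, and `k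
    -- + 2` accumulates. Only `x` is disturbed below `k`, and it is restored at the end.
    let I : ℕ → Mem → Prop := fun i s' => s'.arr = s.arr ∧ s'.reg x = i ∧ s'.reg (k + 1) = σ x ∧
      s'.reg (k + 2) = ∑ j ∈ Finset.range i, e.eval (Function.update σ x j) s.arr ∧
      ∀ r < k, r ≠ x → s'.reg r = σ r
    refine (Runs.seq_copy <| Runs.seq_copy <| Runs.seq_const <| Runs.seq_const <|
      Runs.seq (Q := I L) (Runs.loop I (T := e.cost L + 4) ?_ ?_ ?_) fun s₅ hs₅ =>
      Runs.seq_copy <| Runs.copy (Q := Post k s _) ?_).mono ?_ fun _ hs => hs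
    · simpa [Mem.setReg, show k ≠ x by omega] using hL
    · refine ⟨rfl, by simp [Mem.setReg], ?_, ?_, ?_⟩
      · simp [Mem.setReg, show k + 1 ≠ x by omega, show x ≠ k by omega, hσ]
      · simp [Mem.setReg, show k + 2 ≠ x by omega]
      · intro r hr hrx
        simp [Mem.setReg, show r ≠ k + 2 by omega, show r ≠ k + 1 by omega, hr.ne, hrx, hσ]
    · rintro i hi s' ⟨ha, hvx, hs1, hs2, hr⟩ hsk
      have hcg : ∀ r < k, s'.reg r = Function.update σ x i r := by
        intro r hrk
        by_cases hrx : r = x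
        · subst hrx; simp [hvx]
        · simp [hrx, hr r hrk hrx]
      have hL' : s'.reg 1 = L := (hr 1 hk (Ne.symm hx1)).trans hL
      refine ((ih (k := k + 3) (by omega) (he.mono (by omega)) s' hL').seq fun t₁ ⟨hb₁, hb₂, hb₃⟩ =>
        Runs.seq_add <| Runs.seq_const <| Runs.seq_add <| Runs.sub
        (Q := fun s'' => I (i + 1) s'' ∧ s''.reg k = L - (i + 1)) ?_).mono ?_ fun _ hs => hs
      · have hxk : x ≠ k := by omega
        have hxk2 : x ≠ k + 2 := by omega
        have hxk3 : x ≠ k + 3 := by omega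
        refine ⟨⟨?_, ?_, ?_, ?_, ?_⟩, ?_⟩
        · simp [Mem.setReg, hb₁, ha]
        · simp [Mem.setReg, hxk, hxk2, hxk3, hb₃ x (by omega), hvx]
        · simp [Mem.setReg, show k + 1 ≠ x by omega, hb₃ (k + 1) (by omega), hs1]
        · rw [Finset.sum_range_succ]
          simp [Mem.setReg, hxk2.symm, hb₃ (k + 2) (by omega), hs2, hb₂, ha,
            eval_congr hk he hcg]
        · intro r hrk hrx
          simp [Mem.setReg, hrk.ne, hrx, show r ≠ k + 2 by omega, show r ≠ k + 3 by omega,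
            hb₃ r (by omega), hr r hrk hrx]
        · simp [Mem.setReg, hxk.symm, hxk3.symm, hb₃ k (by omega), hsk]
          omega
      · omega
    · obtain ⟨ha, hvx, hs1, hs2, hr⟩ := hs₅
      refine ⟨by simp [Mem.setReg, ha], ?_, ?_⟩
      · simp [Mem.setReg, show k ≠ x by omega, hs2, eval, ← hL, hσ]
      · intro r hrk
        by_cases hrx : r = x
        · subst hrx; simp [Mem.setReg, hs1, hσ]
        · simp [Mem.setReg, hrx, hrk.ne, hr r hrk hrx, hσ]
    · simp only [cost]; ring_nf; omega

/-- Each sum multiplies the cost by at most the loop bound up to constants, and the nesting depth is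
fixed by the term. -/
theorem exists_cost_le (e : Tm) : ∃ c, ∀ L, e.cost L ≤ c * (L + 1) ^ c := by
  have key : ∀ {c d L : ℕ}, c ≤ d → c * (L + 1) ^ c ≤ d * (L + 1) ^ d := fun h =>
    Nat.mul_le_mul h (Nat.pow_le_pow_right (by omega) h)
  have one : ∀ c L : ℕ, 1 ≤ (L + 1) ^ c := fun c L => Nat.one_le_pow _ _ (by omega)
  induction e with
  | var | const => exact ⟨1, fun L => by simp [cost]⟩
  | add e f ihe ihf | sub e f ihe ihf =>
    obtain ⟨c, hc⟩ := ihe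
    obtain ⟨d, hd⟩ := ihf
    refine ⟨c + d + 1, fun L => ?_⟩
    have h1 := Nat.pow_le_pow_right (n := L + 1) (by omega) (show c ≤ c + d + 1 by omega)
    have h2 := Nat.pow_le_pow_right (n := L + 1) (by omega) (show d ≤ c + d + 1 by omega)
    have h3 := one (c + d + 1) L
    simp only [cost]
    calc _ ≤ c * (L + 1) ^ (c + d + 1) + d * (L + 1) ^ (c + d + 1) + (L + 1) ^ (c + d + 1) := by
          gcongr
          · exact (hc L).trans (Nat.mul_le_mul_left _ h1)
          · exact (hd L).trans (Nat.mul_le_mul_left _ h2)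
      _ = _ := by ring
  | read a e ih =>
    obtain ⟨c, hc⟩ := ih
    refine ⟨c + 1, fun L => ?_⟩
    have h1 := Nat.pow_le_pow_right (n := L + 1) (by omega) (show c ≤ c + 1 by omega)
    have h3 := one (c + 1) L
    simp only [cost]
    calc _ ≤ c * (L + 1) ^ (c + 1) + (L + 1) ^ (c + 1) := by
          gcongr
          exact (hc L).trans (Nat.mul_le_mul_left _ h1)
      _ = _ := by ring
  | ite b e f ihb ihe ihf =>
    obtain ⟨a, ha⟩ := ihb
    obtain ⟨c, hc⟩ := ihe
    obtain ⟨d, hd⟩ := ihf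
    refine ⟨a + c + d + 1, fun L => ?_⟩
    have h0 := Nat.pow_le_pow_right (n := L + 1) (by omega) (show a ≤ a + c + d + 1 by omega)
    have h1 := Nat.pow_le_pow_right (n := L + 1) (by omega) (show c ≤ a + c + d + 1 by omega)
    have h2 := Nat.pow_le_pow_right (n := L + 1) (by omega) (show d ≤ a + c + d + 1 by omega)
    have h3 := one (a + c + d + 1) L
    simp only [cost]
    calc _ ≤ a * (L + 1) ^ (a + c + d + 1) + c * (L + 1) ^ (a + c + d + 1) +
          d * (L + 1) ^ (a + c + d + 1) + (L + 1) ^ (a + c + d + 1) := by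
          gcongr
          · exact (ha L).trans (Nat.mul_le_mul_left _ h0)
          · exact (hc L).trans (Nat.mul_le_mul_left _ h1)
          · exact (hd L).trans (Nat.mul_le_mul_left _ h2)
      _ = _ := by ring
  | sum x e ih =>
    obtain ⟨c, hc⟩ := ih
    -- Here `12 = 5 + 7` collects the overhead per round and outside the loop; the loop itself
    -- raises the exponent by one.
    refine ⟨c + 12, fun L => ?_⟩
    have h1 := Nat.pow_le_pow_right (n := L + 1) (by omega) (show c + 1 ≤ c + 12 by omega)
    have h3 := one c L
    have h4 := one (c + 1) L
    simp only [cost]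
    calc L * (e.cost L + 5) + 7
        ≤ (L + 1) * (c * (L + 1) ^ c + 5 * (L + 1) ^ c) + 7 * (L + 1) ^ (c + 1) := by
          gcongr
          · omega
          · exact hc L
          · omega
          · omega
      _ = (c + 12) * (L + 1) ^ (c + 1) := by ring
      _ ≤ _ := Nat.mul_le_mul_left _ h1

/-! ### Filling tables by course-of-values recursion -/

/-- The table filled by course-of-values recursion with the term `e`, where register `3` holds the
index. -/
def table (e : Tm) (a : ℕ) (σ : ℕ → ℕ) (A : ℕ → ℕ → ℕ) : ℕ → ℕ
  | i => e.eval (Function.update σ 3 i)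
      (Function.update A a fun j => if _h : j < i then table e a σ A j else A a j)
termination_by i => i

/-- Fill the cells of array `a` below the content of register `1` by the values of `e`. -/
def fill (k a : ℕ) (e : Tm) : Prog :=
  .seq (.const 3 0) (.seq (.copy k 1) (.loop k (.seq (e.comp (k + 1)) (.seq (.store a 3 (k + 1))
    (.seq (.const (k + 1) 1) (.seq (.add 3 3 (k + 1)) (.sub k k (k + 1))))))))

/-- The loop has the shape of the one for a sum over register `3`, with a store in place of the
accumulation, so the cost of that sum bounds it. -/
theorem fill_spec (e : Tm) {k L : ℕ} (hk : 3 < k) (a : ℕ) (h : e.WF k) (s : Mem)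
    (hL : s.reg 1 = L) :
    Runs (fill k a e) s ((Tm.sum 3 e).cost L) fun s' =>
      s'.arr = Function.update s.arr a
        (fun j => if j < L then table e a s.reg s.arr j else s.arr a j) ∧
      ∀ r < k, r ≠ 3 → s'.reg r = s.reg r := by
  set σ := s.reg with hσ
  let I : ℕ → Mem → Prop := fun i s' => s'.arr = Function.update s.arr a
        (fun j => if j < i then table e a σ s.arr j else s.arr a j) ∧ s'.reg 3 = i ∧
      ∀ r < k, r ≠ 3 → s'.reg r = σ r
  refine (Runs.seq_const <| Runs.seq_copy <| Runs.loop (N := L) I (T := e.cost L + 4)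
    ?_ ?_ ?_).mono ?_ fun s' hs' => ⟨hs'.1, hs'.2.2⟩
  · simpa [Mem.setReg] using hL
  · refine ⟨by simp [Mem.setReg], by simp [Mem.setReg, show 3 ≠ k by omega], fun r hr h3 => ?_⟩
    simp [Mem.setReg, hr.ne, h3, hσ]
  · rintro i hi s' ⟨ha, h3, hr⟩ hsk
    have hcg : ∀ r < k, s'.reg r = Function.update σ 3 i r := by
      intro r hrk
      by_cases hrx : r = 3
      · subst hrx; simp [h3]
      · simp [hrx, hr r hrk hrx]
    have hL' : s'.reg 1 = L := (hr 1 (by omega) (by omega)).trans hL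
    refine ((comp_spec e (k := k + 1) (by omega) (h.mono (by omega)) s' hL').seq
      fun t₁ ⟨hb₁, hb₂, hb₃⟩ => Runs.seq_store <| Runs.seq_const <| Runs.seq_add <|
      Runs.sub (Q := fun s'' => I (i + 1) s'' ∧ s''.reg k = L - (i + 1))
        ?_).mono ?_ fun _ hs => hs
    · have h3k : 3 ≠ k := by omega
      have h3k1 : 3 ≠ k + 1 := by omega
      refine ⟨⟨?_, ?_, ?_⟩, ?_⟩
      -- The cells below `i` already hold their final values and the others their old ones, which is
      -- exactly the array that one unfolding of `table` reads.
      · have ht : e.eval s'.reg s'.arr = table e a σ s.arr i := by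
          rw [eval_congr (by omega) h hcg, ha, table]
          simp only [dite_eq_ite]
        simp only [Mem.setReg, Mem.setArr, hb₁, hb₂, hb₃ 3 (by omega), h3, ht]
        rw [ha]
        funext b j
        by_cases hb : b = a
        · subst hb
          by_cases hj : j = i
          · subst hj; simp
          · have : j < i + 1 ↔ j < i := by omega
            simp only [Function.update_self, Function.update_of_ne hj, this]
        · simp [hb]
      · simp [Mem.setReg, Mem.setArr, h3k, h3k1, hb₃ 3 (by omega), h3]
      · intro r hrk hrx
        simp [Mem.setReg, Mem.setArr, hrk.ne, hrx, show r ≠ k + 1 by omega,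
          hb₃ r (by omega), hr r hrk hrx]
      · simp [Mem.setReg, Mem.setArr, h3k.symm, h3k1.symm, hb₃ k (by omega), hsk]
        omega
    · omega
  · simp only [cost, Nat.add_assoc, Nat.reduceAdd]; omega

/-- Assign the value of `e` to register `r`. -/
def assign (k r : ℕ) (e : Tm) : Prog := .seq (e.comp k) (.copy r k)

theorem assign_spec (e : Tm) {k L : ℕ} (hk : 1 < k) {r : ℕ} (h : e.WF k) (s : Mem)
    (hL : s.reg 1 = L) : Runs (assign k r e) s (e.cost L + 1) fun s' =>
      s'.arr = s.arr ∧ s'.reg r = e.eval s.reg s.arr ∧ ∀ x < k, x ≠ r → s'.reg x = s.reg x := by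
  refine (comp_spec e hk h s hL).seq fun s₁ ⟨h₁, h₂, h₃⟩ => Runs.copy ⟨?_, ?_, ?_⟩
  · simp [Mem.setReg, h₁]
  · simp [Mem.setReg, h₂]
  · intro x hx hxr
    simp [Mem.setReg, hxr, h₃ x hx]

end Tm

end RAM

/-! ### Bad triples, modulators and edge counts -/

section GraphTheory

open Finset Classical

variable {V : Type*}

/-- The number of neighbours of `z` in `B`. -/
noncomputable def degIn (G : SimpleGraph V) (B : Finset V) (z : V) : ℕ := #{v ∈ B | G.Adj z v}

/-- Three vertices that induce an edge and an isolated vertex. -/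
def IsBadTriple (G : SimpleGraph V) (a b c : V) : Prop :=
  G.Adj a b ∧ ¬G.Adj a c ∧ ¬G.Adj b c ∧ a ≠ c ∧ b ≠ c

/-- If the triple avoided `U`, then in the complement `a` and `b` would be joined through `c`, so
they would lie in one component, hence in one clique, although they are adjacent in `G`. -/
theorem IsCoclusterModulator.mem_of_isBadTriple {G : SimpleGraph V} {U : Finset V}
    (hU : IsCoclusterModulator G U) {a b c : V} (h : IsBadTriple G a b c) :
    a ∈ U ∨ b ∈ U ∨ c ∈ U := by
  by_contra! hn
  obtain ⟨ha, hb, hc⟩ := hn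
  obtain ⟨hab, hac, hbc, hac', hbc'⟩ := h
  let H := (G.induce ((U : Set V)ᶜ))ᶜ
  let a' : ((U : Set V)ᶜ : Set V) := ⟨a, by simpa using ha⟩
  let b' : ((U : Set V)ᶜ : Set V) := ⟨b, by simpa using hb⟩
  let c' : ((U : Set V)ᶜ : Set V) := ⟨c, by simpa using hc⟩
  have h1 : H.Adj a' c' := by simp [H, a', c', hac, hac']
  have h2 : H.Adj b' c' := by simp [H, b', c', hbc, hbc']
  have := hU (H.connectedComponentMk a') (x := a') rfl (y := b')
    (SimpleGraph.ConnectedComponent.sound (h2.reachable.trans h1.reachable.symm))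
    (fun h => hab.ne (congrArg Subtype.val h))
  simp [a', b', hab] at this

/-- A packing of bad triples covers at most three times as many vertices as there are in a
modulator. -/
theorem card_packing_le [DecidableEq V] {G : SimpleGraph V} {U W : Finset V} (hU : IsCoclusterModulator G U)
    (F : Finset (V × V × V)) (hF : ∀ x ∈ F, IsBadTriple G x.1 x.2.1 x.2.2)
    (hdisj : ∀ x ∈ F, ∀ y ∈ F, x ≠ y →
      Disjoint ({x.1, x.2.1, x.2.2} : Finset V) {y.1, y.2.1, y.2.2})
    (hW : ∀ v ∈ W, ∃ x ∈ F, v = x.1 ∨ v = x.2.1 ∨ v = x.2.2) : #W ≤ 3 * #U := by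
  have hhit : ∀ x ∈ F, ∃ u ∈ U, u ∈ ({x.1, x.2.1, x.2.2} : Finset V) := by
    intro x hx
    rcases hU.mem_of_isBadTriple (hF x hx) with h | h | h
    · exact ⟨_, h, by simp⟩
    · exact ⟨_, h, by simp⟩
    · exact ⟨_, h, by simp⟩
  obtain ⟨f, hf⟩ := Classical.axiomOfChoice (r := fun (x : F) u => u ∈ U ∧
    u ∈ ({x.1.1, x.1.2.1, x.1.2.2} : Finset V)) fun x => hhit x x.2
  have h1 : #F ≤ #U := by
    rw [← card_attach]
    refine card_le_card_of_injOn f (fun x _ => (hf x).1) fun x _ y _ hxy => ?_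
    by_contra hne
    exact disjoint_left.1 (hdisj x x.2 y y.2 fun h => hne (Subtype.ext h)) (hf x).2
      (hxy ▸ (hf y).2)
  have h2 : W ⊆ F.biUnion fun x => {x.1, x.2.1, x.2.2} := by
    intro v hv
    obtain ⟨x, hx, h⟩ := hW v hv
    exact mem_biUnion.2 ⟨x, hx, by simpa using h⟩
  have h3 := card_biUnion_le_card_mul F (fun x => ({x.1, x.2.1, x.2.2} : Finset V)) 3
    fun x _ => card_le_three
  have := card_le_card h2
  omega

theorem exists_adj_of_connected_induce {G : SimpleGraph V} {S : Set V}
    (hS : (G.induce S).Connected) (Z : Set V) {c b : V} (hc : c ∈ S) (hcZ : c ∈ Z) (hb : b ∈ S)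
    (hbZ : b ∉ Z) : ∃ u ∈ S, u ∈ Z ∧ ∃ v ∈ S, v ∉ Z ∧ G.Adj u v := by
  obtain ⟨w⟩ := hS.preconnected ⟨c, hc⟩ ⟨b, hb⟩
  obtain ⟨d, _, h1, h2⟩ := w.exists_boundary_dart {x | x.1 ∈ Z} hcZ hbZ
  exact ⟨_, d.fst.2, h1, _, d.snd.2, h2, d.adj⟩

theorem connected_induce_of_reflTransGen {G : SimpleGraph V} {S : Set V} {c : V} (hc : c ∈ S)
    (h : ∀ x ∈ S, Relation.ReflTransGen (fun a b => b ∈ S ∧ G.Adj a b) c x) :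
    (G.induce S).Connected := by
  have key : ∀ x, Relation.ReflTransGen (fun a b => b ∈ S ∧ G.Adj a b) c x →
      ∃ hx : x ∈ S, (G.induce S).Reachable ⟨c, hc⟩ ⟨x, hx⟩ := by
    intro x hx
    induction hx with
    | refl => exact ⟨hc, .rfl⟩
    | tail _ hbc ih =>
      obtain ⟨hb, hr⟩ := ih
      refine ⟨hbc.1, hr.trans (SimpleGraph.Adj.reachable ?_)⟩
      simpa using hbc.2
  have : Nonempty S := ⟨⟨c, hc⟩⟩
  refine SimpleGraph.Connected.mk fun x y => ?_
  obtain ⟨_, h1⟩ := key x (h x x.2)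
  obtain ⟨_, h2⟩ := key y (h y y.2)
  exact h1.symm.trans h2

theorem two_mul_card_edgeFinset_induce (G : SimpleGraph V) (S : Finset V) :
    2 * Nat.card (G.induce (S : Set V)).edgeSet = ∑ x ∈ S, degIn G S x := by
  rw [Nat.card_eq_fintype_card, ← SimpleGraph.edgeFinset_card,
    ← SimpleGraph.sum_degrees_eq_twice_card_edges, ← Finset.sum_coe_sort S]
  refine Finset.sum_congr rfl fun x _ => ?_
  rw [← SimpleGraph.card_neighborFinset_eq_degree, degIn]
  refine card_bij (fun y _ => y.1) ?_ ?_ ?_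
  · intro y hy
    simpa using hy
  · intro y _ z _ h
    exact Subtype.ext h
  · intro y hy
    obtain ⟨h1, h2⟩ := mem_filter.1 hy
    exact ⟨⟨y, h1⟩, by simpa using h2, rfl⟩

/-- An upper bound on the degree sum is enough, since connectivity forces the reverse inequality. -/
theorem isTree_induce_of_sum_degIn_le {G : SimpleGraph V} {S : Finset V}
    (hS : (G.induce (S : Set V)).Connected) (h : ∑ x ∈ S, degIn G S x + 2 ≤ 2 * #S) :
    (G.induce (S : Set V)).IsTree := by
  rw [SimpleGraph.isTree_iff_connected_and_card]
  refine ⟨hS, ?_⟩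
  have h1 := two_mul_card_edgeFinset_induce G S
  have h2 := hS.card_vert_le_card_edgeSet_add_one
  have h3 : Nat.card (S : Set V) = #S := by simp
  omega

theorem sum_degIn_of_isTree {G : SimpleGraph V} {S : Finset V}
    (h : (G.induce (S : Set V)).IsTree) : ∑ x ∈ S, degIn G S x + 2 = 2 * #S := by
  rw [SimpleGraph.isTree_iff_connected_and_card] at h
  have h1 := two_mul_card_edgeFinset_induce G S
  have h3 : Nat.card (S : Set V) = #S := by simp
  omega

variable [DecidableEq V]

/-- There are no edges inside `I`, and each edge between `B` and `I` is counted from both ends. -/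
theorem sum_degIn_union {G : SimpleGraph V} {B I : Finset V} (hBI : Disjoint B I)
    (hI : ∀ x ∈ I, ∀ y ∈ I, ¬G.Adj x y) :
    ∑ x ∈ B ∪ I, degIn G (B ∪ I) x = ∑ x ∈ B, degIn G B x + 2 * ∑ x ∈ I, degIn G B x := by
  have h1 : ∀ x, degIn G (B ∪ I) x = degIn G B x + degIn G I x := by
    intro x
    rw [degIn, filter_union, card_union_of_disjoint (disjoint_filter_filter hBI)]
    rfl
  have h2 : ∑ x ∈ I, degIn G I x = 0 := by
    refine Finset.sum_eq_zero fun x hx => ?_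
    rw [degIn, card_eq_zero, filter_eq_empty_iff]
    exact fun y hy => hI x hx y hy
  have h3 : ∑ x ∈ B, degIn G I x = ∑ x ∈ I, degIn G B x := by
    simp only [degIn, card_filter]
    rw [sum_comm]
    simp only [G.adj_comm]
  simp only [h1, sum_union hBI, sum_add_distrib, h2, h3]
  ring

/-! ### Growing a tree over a fixed base -/

/-- The vertices `z` that may be used to extend a partial tree with the vertices `Y` in the base. -/
def IsAgent (G : SimpleGraph V) (pool Y : Finset V) (z : V) : Prop :=
  z ∈ Y ∨ z ∈ pool ∧ ∃ y ∈ Y, G.Adj y z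

/-- The price of using the vertex `z`: the number of independent cycles and components it may
cost. -/
noncomputable def price (G : SimpleGraph V) (B pool K : Finset V) (z : V) : ℕ :=
  if z ∈ pool ∧ z ∉ K then degIn G B z - 1 else 0

/-- The vertices `X` of the base `B` can be connected to `c` at price `d`. -/
inductive Grow (G : SimpleGraph V) (B pool K : Finset V) (c : V) : Finset V → ℕ → Prop
  | base {X : Finset V} {d : ℕ} : X ⊆ {c} → Grow G B pool K c X d
  | step {X Y : Finset V} {d d' : ℕ} {z : V} : Grow G B pool K c Y d' → IsAgent G pool Y z →
      d' + price G B pool K z ≤ d → X ⊆ Y ∪ {v ∈ B | G.Adj z v} → Grow G B pool K c X d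

variable {G : SimpleGraph V} {B pool K : Finset V} {c : V}

/-- Let `J` collect the agents that are non-terminal pool vertices; all other agents are present in
`S` anyway. An agent used repeatedly enters `J` only once while `d` never decreases, so `d` bounds
the surplus of `J` from above. -/
theorem Grow.exists_connecting {X : Finset V} {d : ℕ} (h : Grow G B pool K c X d) :
    ∃ J ⊆ pool \ K, ∑ w ∈ J, degIn G B w ≤ d + #J ∧ ∀ S : Set V, c ∈ S → (B : Set V) ⊆ S →
      ((pool ∩ K : Finset V) : Set V) ⊆ S → (J : Set V) ⊆ S →
      ∀ x ∈ X ∪ J, Relation.ReflTransGen (fun a b => b ∈ S ∧ G.Adj a b) c x := by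
  induction h with
  | base hX =>
    refine ⟨∅, by simp, by simp, fun S _ _ _ _ x hx => ?_⟩
    have : x = c := by simpa using hX (by simpa using hx)
    exact this ▸ .refl
  | @step X Y d d' z _ hz hd hX ih =>
    obtain ⟨J, hJ, hsum, hconn⟩ := ih
    have hJz : ∃ J' ⊆ pool \ K, J ⊆ J' ∧ J' ⊆ insert z J ∧ (z ∈ pool \ K → z ∈ J') ∧
        ∑ w ∈ J', degIn G B w ≤ d + #J' := by
      by_cases hzp : z ∈ pool \ K
      · by_cases hzJ : z ∈ J
        · exact ⟨J, hJ, subset_rfl, subset_insert _ _, fun _ => hzJ, by omega⟩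
        · refine ⟨insert z J, insert_subset hzp hJ, subset_insert _ _, subset_rfl,
            fun _ => mem_insert_self _ _, ?_⟩
          rw [sum_insert hzJ, card_insert_of_notMem hzJ]
          -- Truncation is harmless: `degIn - 1 + 1` is at least `degIn` even for a vertex without
          -- neighbours in `B`.
          rw [price, if_pos (by simpa using hzp)] at hd
          omega
      · exact ⟨J, hJ, subset_rfl, subset_insert _ _, fun h => absurd h hzp, by omega⟩
    obtain ⟨J', hJ', hJJ', hzJ, hzJ', hsum'⟩ := hJz
    refine ⟨J', hJ', hsum', fun S hc hB hT hS x hx => ?_⟩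
    have hconn' := hconn S hc hB hT ((coe_subset.2 hJJ').trans hS)
    have hreach : Relation.ReflTransGen (fun a b => b ∈ S ∧ G.Adj a b) c z := by
      rcases hz with hz | ⟨hz, y, hy, hyz⟩
      · exact hconn' z (mem_union_left _ hz)
      · refine (hconn' y (mem_union_left _ hy)).tail ⟨?_, hyz⟩
        by_cases hzK : z ∈ K
        · exact hT (by simp [hz, hzK])
        · exact hS (hzJ' (by simp [hz, hzK]))
    rcases mem_union.1 hx with hx | hx
    · rcases mem_union.1 (hX hx) with hx | hx
      · exact hconn' x (mem_union_left _ hx)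
      · obtain ⟨hxB, hzx⟩ := mem_filter.1 hx
        exact hreach.tail ⟨hB hxB, hzx⟩
    · rcases mem_insert.1 (hzJ hx) with rfl | hx
      · exact hreach
      · exact hconn' x (mem_union_right _ hx)

/-- The tree consists of `B`, the terminals in the pool and the bought vertices `J`. A pool terminal
hangs on any of its neighbours in `B`; the inequality on `d` is the edge count of a tree. -/
theorem hasInducedTreeContaining_of_grow (hc : c ∈ B) (hdisj : Disjoint B pool)
    (hpool : ∀ x ∈ pool, ∀ y ∈ pool, ¬G.Adj x y) (hK : K ⊆ B ∪ pool)
    (hdeg : ∀ t ∈ pool ∩ K, degIn G B t ≠ 0) {d : ℕ} (h : Grow G B pool K c B d)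
    (hd : 2 * d + ∑ x ∈ B, degIn G B x + 2 * ∑ t ∈ pool ∩ K, degIn G B t + 2 ≤
      2 * (#B + #(pool ∩ K))) : HasInducedTreeContaining G K := by
  obtain ⟨J, hJ, hsum, hconn⟩ := h.exists_connecting
  set T := pool ∩ K with hT
  have hTJ : Disjoint T J := by
    rw [disjoint_left]
    intro x hx hxJ
    exact (mem_sdiff.1 (hJ hxJ)).2 (mem_inter.1 hx).2
  have hIp : T ∪ J ⊆ pool := union_subset inter_subset_left (hJ.trans sdiff_subset)
  have hBI : Disjoint B (T ∪ J) := hdisj.mono_right hIp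
  refine ⟨(B ∪ (T ∪ J) : Finset V), ?_, ?_⟩
  · intro x hx
    have hx' : x ∈ K := hx
    rcases mem_union.1 (hK hx') with h | h
    · simp [h]
    · simp [hT, h, hx']
  · have hBS : (B : Set V) ⊆ (B ∪ (T ∪ J) : Finset V) := coe_subset.2 subset_union_left
    have hreach := hconn (B ∪ (T ∪ J) : Finset V) (hBS hc) hBS
      (coe_subset.2 (subset_union_left.trans subset_union_right))
      (coe_subset.2 (subset_union_right.trans subset_union_right))
    refine isTree_induce_of_sum_degIn_le (connected_induce_of_reflTransGen (c := c) (hBS hc) ?_) ?_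
    · intro x hx
      rcases mem_union.1 (mem_coe.1 hx) with h | h
      · exact hreach x (mem_union_left _ h)
      rcases mem_union.1 h with h | h
      · obtain ⟨b, hb⟩ := card_ne_zero.1 (hdeg x h)
        obtain ⟨hbB, hxb⟩ := mem_filter.1 hb
        exact (hreach b (mem_union_left _ hbB)).tail ⟨hx, hxb.symm⟩
      · exact hreach x (mem_union_right _ h)
    · rw [sum_degIn_union hBI fun x hx y hy => hpool x (hIp hx) y (hIp hy), sum_union hTJ,
        card_union_of_disjoint hBI, card_union_of_disjoint hTJ]
      omega

/-- Every tree in `B ∪ pool` that contains the base `B` is found by growing it from `c`. -/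
theorem exists_grow_of_isTree {S : Finset V} (hS : (G.induce (S : Set V)).IsTree) (hc : c ∈ B)
    (hdisj : Disjoint B pool) (hpool : ∀ x ∈ pool, ∀ y ∈ pool, ¬G.Adj x y) (hBS : B ⊆ S)
    (hSB : S ⊆ B ∪ pool) (hK : K ⊆ S) (P : Finset V → ℕ → Prop) (hbase : P {c} 0)
    (hstep : ∀ Y d z, P Y d → c ∈ Y → Y ⊆ B → IsAgent G pool Y z →
      Y ⊂ Y ∪ {v ∈ B | G.Adj z v} → (2 * (d + price G B pool K z) + 2 ≤ 2 * #S) →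
      P (Y ∪ {v ∈ B | G.Adj z v}) (d + price G B pool K z)) :
    (∀ t ∈ pool ∩ K, degIn G B t ≠ 0) ∧ ∃ d, P B d ∧
      2 * d + ∑ x ∈ B, degIn G B x + 2 * ∑ t ∈ pool ∩ K, degIn G B t + 2 ≤
        2 * (#B + #(pool ∩ K)) := by
  set T := pool ∩ K with hT
  set I := S \ B with hI
  have hIp : I ⊆ pool := by
    intro x hx
    obtain ⟨h1, h2⟩ := mem_sdiff.1 hx
    exact (mem_union.1 (hSB h1)).resolve_left h2
  have hSe : S = B ∪ I := by rw [hI, union_sdiff_of_subset hBS]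
  have hBI : Disjoint B I := disjoint_sdiff
  have hTI : T ⊆ I := by
    intro x hx
    obtain ⟨h1, h2⟩ := mem_inter.1 hx
    exact mem_sdiff.2 ⟨hK h2, fun h => disjoint_left.1 hdisj h h1⟩
  have hdeg : ∀ w ∈ I, degIn G B w ≠ 0 := by
    intro w hw
    obtain ⟨u, huS, rfl, v, hvS, hv, huv⟩ := exists_adj_of_connected_induce hS.connected {w}
      (mem_coe.2 (mem_sdiff.1 hw).1) rfl (mem_coe.2 (hBS hc))
      (fun h => disjoint_left.1 hBI hc (h ▸ hw))
    refine card_ne_zero.2 ⟨v, mem_filter.2 ⟨?_, huv⟩⟩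
    by_contra hvB
    exact hpool u (hIp hw) v (hIp (mem_sdiff.2 ⟨hvS, hvB⟩)) huv
  refine ⟨fun t ht => hdeg t (hTI ht), ?_⟩
  have hsum := sum_degIn_of_isTree hS
  rw [hSe, sum_degIn_union hBI fun x hx y hy => hpool x (hIp hx) y (hIp hy),
    card_union_of_disjoint hBI, ← union_sdiff_of_subset hTI, sum_union disjoint_sdiff,
    card_union_of_disjoint disjoint_sdiff] at hsum
  have hprice : ∑ w ∈ I \ T, price G B pool K w + #(I \ T) = ∑ w ∈ I \ T, degIn G B w := by
    rw [card_eq_sum_ones, ← sum_add_distrib]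
    refine Finset.sum_congr rfl fun w hw => ?_
    obtain ⟨h1, h2⟩ := mem_sdiff.1 hw
    have h3 := hdeg w h1
    rw [price, if_pos ⟨hIp h1, fun h => h2 (mem_inter.2 ⟨hIp h1, h⟩)⟩]
    omega
  have hBcard : 2 * (#B + #T) ≤ 2 * #S := by
    rw [← card_union_of_disjoint (hBI.mono_right hTI)]
    have := card_le_card (union_subset hBS (hTI.trans sdiff_subset) : B ∪ T ⊆ S)
    omega
  -- Induction on the part of `B` not yet reached. `J` is the set of vertices bought so far; all
  -- their neighbours in `B` are already in `Y`, which prevents paying twice.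
  suffices H : ∀ m Y J d, #(B \ Y) = m → P Y d → c ∈ Y → Y ⊆ B → J ⊆ I \ T →
      d ≤ ∑ w ∈ J, price G B pool K w → (∀ w ∈ J, ∀ v ∈ B, G.Adj w v → v ∈ Y) →
      ∃ d', P B d' ∧ d' ≤ ∑ w ∈ I \ T, price G B pool K w by
    obtain ⟨d, hd, hle⟩ := H _ {c} ∅ 0 rfl hbase (by simp) (by simpa using hc) (by simp) (by simp)
      (by simp)
    exact ⟨d, hd, by omega⟩
  intro m
  induction m using Nat.strong_induction_on with
  | _ m ih =>
  intro Y J d hm hP hcY hYB hJ hd hJY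
  by_cases hYB' : B ⊆ Y
  · obtain rfl := subset_antisymm hYB hYB'
    exact ⟨d, hP, hd.trans (sum_le_sum_of_subset hJ)⟩
  obtain ⟨b, hbB, hbY⟩ := not_subset.1 hYB'
  -- Cut the tree around `Y` and its neighbours in `I`. As `I` is independent, an edge leaving this
  -- set ends in `B` outside `Y`, and its inner end is an agent.
  obtain ⟨u, huS, huZ, v, hvS, hvZ, huv⟩ := exists_adj_of_connected_induce hS.connected
    {x | x ∈ Y ∨ x ∈ I ∧ ∃ y ∈ Y, G.Adj y x} (mem_coe.2 (hBS hc)) (Or.inl hcY)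
    (mem_coe.2 (hBS hbB)) (by
      rintro (h | ⟨h, -⟩)
      · exact hbY h
      · exact disjoint_left.1 hBI hbB h)
  simp only [Set.mem_ofPred_eq, not_or] at huZ hvZ
  have hvI : v ∉ I := by
    intro hvI
    rcases huZ with h | ⟨h, -⟩
    · exact hvZ.2 ⟨hvI, u, h, huv⟩
    · exact hpool u (hIp h) v (hIp hvI) huv
  have hvB : v ∈ B := by
    by_contra h
    exact hvI (mem_sdiff.2 ⟨hvS, h⟩)
  have hagent : IsAgent G pool Y u := huZ.imp_right fun h => ⟨hIp h.1, h.2⟩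
  have hss : Y ⊂ Y ∪ {v ∈ B | G.Adj u v} :=
    ⟨subset_union_left, fun h => hvZ.1 (h (by simp [hvB, huv]))⟩
  have hJu : ∃ J' ⊆ I \ T, J' ⊆ insert u J ∧
      d + price G B pool K u ≤ ∑ w ∈ J', price G B pool K w := by
    by_cases hup : u ∈ pool ∧ u ∉ K
    -- Were `u` already bought, its neighbour `v` would have been reached.
    · have huJ : u ∉ J := fun h => hvZ.1 (hJY u h v hvB huv)
      refine ⟨insert u J, insert_subset ?_ hJ, subset_rfl, ?_⟩
      · exact mem_sdiff.2 ⟨mem_sdiff.2 ⟨huS, fun h => disjoint_left.1 hdisj h hup.1⟩,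
          fun h => hup.2 (mem_inter.1 h).2⟩
      · rw [sum_insert huJ]; omega
    · exact ⟨J, hJ, subset_insert _ _, by rw [price, if_neg hup]; exact hd⟩
  obtain ⟨J', hJ', hJu, hd'⟩ := hJu
  refine ih _ ?_ (Y ∪ {v ∈ B | G.Adj u v}) J' _ rfl (hstep Y d u hP hcY hYB hagent hss ?_)
    (mem_union_left _ hcY) (union_subset hYB (filter_subset _ _)) hJ' hd' ?_
  · rw [← hm]
    refine card_lt_card ⟨sdiff_subset_sdiff subset_rfl subset_union_left, fun h => ?_⟩
    exact (mem_sdiff.1 (h (mem_sdiff.2 ⟨hvB, hvZ.1⟩))).2 (by simp [hvB, huv])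
  · have := sum_le_sum_of_subset (f := price G B pool K) hJ'
    omega
  · intro w hw x hx hwx
    rcases mem_insert.1 (hJu hw) with rfl | hw
    · simp [hx, hwx]
    · exact mem_union_left _ (hJY w hw x hx hwx)

variable [Fintype V]

/-! ### Trees outside a modulator -/

/-- The vertices outside `U` and in the part of `p`, without `c`. -/
noncomputable def poolOf (G : SimpleGraph V) (U : Finset V) (p c : V) : Finset V :=
  {w | w ∉ U ∧ p ∉ U ∧ ¬G.Adj w p ∧ w ≠ c}

variable {U : Finset V}

/-- Two adjacent vertices of the pool would form a bad triple with `p`. -/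
theorem not_adj_of_mem_poolOf
    (hU : ∀ a ∉ U, ∀ b ∉ U, ∀ c ∉ U, ¬IsBadTriple G a b c) {p c : V} :
    ∀ x ∈ poolOf G U p c, ∀ y ∈ poolOf G U p c, ¬G.Adj x y := by
  intro x hx y hy hxy
  simp only [poolOf, mem_filter, mem_univ, true_and] at hx hy
  refine hU x hx.1 y hy.1 p hx.2.1 ⟨hxy, hx.2.2.1, hy.2.2.1, ?_, ?_⟩
  · rintro rfl; exact hy.2.2.1 hxy.symm
  · rintro rfl; exact hx.2.2.1 hxy

/-- Outside a modulator, a tree is an independent set up to one vertex. -/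
theorem exists_center (hU : ∀ a ∉ U, ∀ b ∉ U, ∀ c ∉ U, ¬IsBadTriple G a b c) {S : Finset V}
    (hS : (G.induce (S : Set V)).IsTree) :
    ∃ c ∈ S, ∃ p, ∀ w ∈ S, w ∉ U → w ≠ c → w ∈ poolOf G U p c := by
  -- Paths in a tree are unique; this is used to exclude triangles and four-cycles.
  have hcyc : ∀ {x y : V} (p q : G.Walk x y), p.IsPath → q.IsPath → (∀ z ∈ p.support, z ∈ S) →
      (∀ z ∈ q.support, z ∈ S) → p.support = q.support := by
    intro x y p q hp hq hpS hqS
    have hp' : (p.induce (S : Set V) hpS).IsPath := by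
      refine SimpleGraph.Walk.IsPath.of_map (f := (SimpleGraph.Embedding.induce _).toHom) ?_
      rwa [SimpleGraph.Walk.map_induce]
    have hq' : (q.induce (S : Set V) hqS).IsPath := by
      refine SimpleGraph.Walk.IsPath.of_map (f := (SimpleGraph.Embedding.induce _).toHom) ?_
      rwa [SimpleGraph.Walk.map_induce]
    have h := congrArg
      (fun r => (r.1.map (SimpleGraph.Embedding.induce (G := G) (S : Set V)).toHom).support)
      ((hS.isAcyclic.subsingleton_path _ _).elim ⟨_, hp'⟩ ⟨_, hq'⟩)
    simp only [SimpleGraph.Walk.map_induce] at h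
    exact h
  obtain ⟨c, hc⟩ := hS.connected.nonempty
  by_cases hind : ∀ x ∈ S, x ∉ U → ∀ y ∈ S, y ∉ U → ¬G.Adj x y
  · by_cases hp : ∃ p ∈ S, p ∉ U
    · obtain ⟨p, hpS, hpU⟩ := hp
      refine ⟨c, hc, p, fun w hw hwU hwc => ?_⟩
      simp [poolOf, hwU, hpU, hwc, hind w hw hwU p hpS hpU]
    · push Not at hp
      exact ⟨c, hc, c, fun w hw hwU _ => absurd (hp w hw) hwU⟩
  push Not at hind
  obtain ⟨x, hx, hxU, y, hy, hyU, hxy⟩ := hind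
  have htri : ∀ w ∈ S, G.Adj w x → G.Adj w y → False := by
    intro w hw hwx hwy
    have := hcyc (.cons hxy .nil) (.cons hwx.symm (.cons hwy .nil))
      (by simp [hxy.ne]) (by simp [hwx.ne', hwy.ne, hxy.ne]) (by simp [hx, hy])
      (by simp [hx, hy, hw])
    simp at this
  have hor : ∀ w, w ∉ U → w ≠ x → w ≠ y → G.Adj w x ∨ G.Adj w y := by
    intro w hwU hwx hwy
    by_contra! h
    exact hU x hxU y hyU w hwU ⟨hxy, fun h' => h.1 h'.symm, fun h' => h.2 h'.symm, hwx.symm,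
      hwy.symm⟩
  -- One end of the edge `xy` is the centre: `x` if nothing else outside `U` hangs on `y`, and
  -- otherwise `y`.
  by_cases hall : ∀ w ∈ S, w ∉ U → w ≠ x → ¬G.Adj w y
  · refine ⟨x, hx, y, fun w hw hwU hwx => ?_⟩
    simp [poolOf, hwU, hyU, hwx, hall w hw hwU hwx]
  push Not at hall
  obtain ⟨w', hw', hwU', hwx', hwy'⟩ := hall
  refine ⟨y, hy, x, fun w hw hwU hwy => ?_⟩
  have : ¬G.Adj w x := by
    intro hwx
    -- If `w` hangs on `x` and `w'` on `y`, the absence of bad triples forces `w` and `w'` to be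
    -- adjacent, which closes a four-cycle.
    have hww' : G.Adj w w' := by
      by_contra h
      refine hU w' hwU' y hyU w hwU ⟨hwy', fun h' => h h'.symm, ?_, ?_, hwy.symm⟩
      · exact fun h' => htri w hw hwx h'.symm
      · rintro rfl; exact htri w' hw hwx hwy'
    have := hcyc (.cons hxy .nil) (.cons hwx.symm (.cons hww' (.cons hwy' .nil)))
      (by simp [hxy.ne]) (by simp [hwx.ne', hwy'.ne, hxy.ne, hww'.ne, hwy, hwx'.symm])
      (by simp [hx, hy]) (by simp [hx, hy, hw, hw'])
    simp at this
  simp [poolOf, hwU, hxU, hwy, this]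

end GraphTheory

/-! ### A vocabulary of conditions and their meaning -/

namespace RAM

namespace Tm

/-- A term read as a condition. -/
def Holds (e : Tm) (σ : ℕ → ℕ) (A : ℕ → ℕ → ℕ) : Prop := e.eval σ A ≠ 0

def not (p : Tm) : Tm := .ite p (.const 0) (.const 1)
def and (p q : Tm) : Tm := .ite p q (.const 0)
def or (p q : Tm) : Tm := .ite p (.const 1) q
def imp (p q : Tm) : Tm := .ite p q (.const 1)
def lt (e f : Tm) : Tm := .sub f e
def le (e f : Tm) : Tm := (Tm.sub e f).not
def eq (e f : Tm) : Tm := (le e f).and (le f e)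

/-- `p` for some value of the register `x` below the content of register `b`. -/
def ex (b x : ℕ) (p : Tm) : Tm := .sum x ((lt (var x) (var b)).and p)

/-- `p` for all values of the register `x` below the content of register `b`. -/
def all (b x : ℕ) (p : Tm) : Tm := (ex b x p.not).not

/-- The sum of `e` over the values of the register `x` that satisfy `p` and are below the content
of register `0`. -/
def sumIf (x : ℕ) (p e : Tm) : Tm := .sum x (.ite ((lt (var x) (var 0)).and p) e (.const 0))

/-- The product of two terms in which `x` does not occur. -/
def mul (x : ℕ) (e f : Tm) : Tm := .sum x (.ite (lt (var x) e) f (.const 0))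

open Classical in
/-- The sum of `f` over the numbers below `n` and `L` that satisfy `P`. -/
noncomputable def sumN (n L : ℕ) (P : ℕ → Prop) (f : ℕ → ℕ) : ℕ :=
  ∑ i ∈ Finset.range L with i < n ∧ P i, f i

section

variable {σ : ℕ → ℕ} {A : ℕ → ℕ → ℕ} {p q e f : Tm} {x b : ℕ}

theorem holds_read {a : ℕ} : (read a e).Holds σ A ↔ A a (e.eval σ A) ≠ 0 := Iff.rfl

theorem holds_sub : (sub e f).Holds σ A ↔ f.eval σ A < e.eval σ A := by
  simp only [Holds, eval]; omega

theorem holds_not : p.not.Holds σ A ↔ ¬p.Holds σ A := by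
  simp only [Holds, not, eval]; split_ifs <;> simp_all

theorem holds_and : (p.and q).Holds σ A ↔ p.Holds σ A ∧ q.Holds σ A := by
  simp only [Holds, and, eval]; split_ifs <;> simp_all

theorem holds_or : (p.or q).Holds σ A ↔ p.Holds σ A ∨ q.Holds σ A := by
  simp only [Holds, or, eval]; split_ifs <;> simp_all

theorem holds_imp : (p.imp q).Holds σ A ↔ (p.Holds σ A → q.Holds σ A) := by
  simp only [Holds, imp, eval]; split_ifs <;> simp_all

theorem holds_lt : (lt e f).Holds σ A ↔ e.eval σ A < f.eval σ A := holds_sub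

theorem holds_le : (le e f).Holds σ A ↔ e.eval σ A ≤ f.eval σ A := by
  simp only [le, holds_not, holds_sub, not_lt]

theorem holds_eq : (eq e f).Holds σ A ↔ e.eval σ A = f.eval σ A := by
  simp only [eq, holds_and, holds_le, le_antisymm_iff]

/-- A sum of natural numbers is nonzero exactly when some summand is, so truth is nonzeroness and
the sum plays the existential quantifier. -/
theorem holds_ex (h : b ≠ x) : (ex b x p).Holds σ A ↔
    ∃ i, (i < σ b ∧ i < σ 1) ∧ p.Holds (Function.update σ x i) A := by
  have key : ∀ i, ((lt (var x) (var b)).and p).eval (Function.update σ x i) A ≠ 0 ↔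
      i < σ b ∧ p.Holds (Function.update σ x i) A := fun i => by
    have := holds_and (p := lt (var x) (var b)) (q := p) (σ := Function.update σ x i) (A := A)
    simpa only [Holds, holds_lt, eval, Function.update_self, Function.update_of_ne h] using
      this.trans (and_congr_left fun _ => holds_lt)
  rw [Holds, ex, eval, ← Nat.pos_iff_ne_zero, Finset.sum_pos_iff]
  simp only [Finset.mem_range, Nat.pos_iff_ne_zero, key]
  exact exists_congr fun i => by tauto

theorem holds_all (h : b ≠ x) : (all b x p).Holds σ A ↔
    ∀ i, i < σ b ∧ i < σ 1 → p.Holds (Function.update σ x i) A := by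
  simp only [all, holds_not, holds_ex h]
  push Not
  rfl

theorem eval_sumIf (h : x ≠ 0) : (sumIf x p e).eval σ A =
    sumN (σ 0) (σ 1) (fun i => p.Holds (Function.update σ x i) A)
      fun i => e.eval (Function.update σ x i) A := by
  classical
  rw [sumIf, eval, sumN, Finset.sum_filter]
  refine Finset.sum_congr rfl fun i _ => ?_
  have : ((lt (var x) (var 0)).and p).eval (Function.update σ x i) A ≠ 0 ↔
      i < σ 0 ∧ p.Holds (Function.update σ x i) A := by
    refine holds_and.trans (and_congr_left fun _ => ?_)
    simp only [holds_lt, eval, Function.update_self, Function.update_of_ne h.symm]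
  rw [eval]
  simp only [this]
  rfl

/-- The sum stops at the loop bound, so the first factor saturates there. Later stages choose the
bound large enough for this not to matter. -/
theorem eval_mul {v w : ℕ} (he : ∀ i, e.eval (Function.update σ x i) A = v)
    (hf : ∀ i, f.eval (Function.update σ x i) A = w) :
    (mul x e f).eval σ A = min v (σ 1) * w := by
  have h : ∀ i, (lt (var x) e).eval (Function.update σ x i) A ≠ 0 ↔ i < v := fun i => by
    refine holds_lt.trans ?_
    simp only [he, eval, Function.update_self]
  simp only [mul, eval, hf, h]
  rw [← Finset.sum_filter, Finset.sum_const, smul_eq_mul]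
  congr 1
  rw [← Finset.card_range (min v (σ 1))]
  congr 1
  ext i
  simp only [Finset.mem_filter, Finset.mem_range]
  omega

end

/-- Adjacency of the vertices in the registers `x` and `y`. -/
def adjT (x y : ℕ) : Tm := read 0 (add (mul 30 (var x) (var 0)) (var y))

/-- The index of a triple. -/
def tripleT (a b c : ℕ) : Tm :=
  add (mul 30 (add (mul 31 (var a) (var 0)) (var b)) (var 0)) (var c)

/-- The bit of the mask in register `X` that belongs to the vertex in register `v`. -/
def bitT (X v : ℕ) : Tm :=
  ex 1 31 (ex 1 32 ((lt (var 32) (read 5 (read 4 (var v)))).and (eq (var X)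
    (add (mul 33 (var 31) (add (read 5 (read 4 (var v))) (read 5 (read 4 (var v)))))
      (add (read 5 (read 4 (var v))) (var 32))))))

/-- Membership of `v` in the set with mask `X`, or `v = c`. -/
def hatT (X c v : ℕ) : Tm := (eq (var v) (var c)).or ((read 3 (var v)).and (bitT X v))

/-- The number of neighbours of `z` in the set with mask `B` and `c`. -/
def degT (B c z : ℕ) : Tm := sumIf 28 ((hatT B c 28).and (adjT z 28)) (const 1)

def poolT (p c z : ℕ) : Tm :=
  (read 3 (var z)).not.and ((read 3 (var p)).not.and ((adjT z p).not.and
    (eq (var z) (var c)).not))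

def agentT (Y p c z : ℕ) : Tm :=
  (hatT Y c z).or ((poolT p c z).and (ex 0 27 ((hatT Y c 27).and (adjT 27 z))))

def priceT (B p c z : ℕ) : Tm :=
  .ite ((poolT p c z).and (read 1 (var z)).not) (sub (degT B c z) (const 1)) (const 0)

/-- The index of the cell of the table of partial trees for base `B`, centre `c`, part `p`,
price `d` and mask `X`. -/
def cellT (B c p d X : ℕ) : Tm :=
  add (mul 40 (add (mul 41 (add (mul 42 (add (mul 43 (var B) (var 0)) (var c)) (var 0)) (var p))
    (var 0)) (var d)) (var 2)) (var X)

/-! ### Numerical counterparts of the terms, products saturating at `L` -/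

section

variable (A : ℕ → ℕ → ℕ) (n L : ℕ)

def AdjN (x y : ℕ) : Prop := A 0 (min x L * n + y) ≠ 0

def tripleN (a b c : ℕ) : ℕ := min (min a L * n + b) L * n + c

/-- There is no division, so bit `i` of `X` is expressed by `X = h * 2 ^ (i + 1) + 2 ^ i + l` with
`l < 2 ^ i`. Array `4` is meant to hold the bit position `i` of `v`, and array `5` the powers of
two. -/
def BitN (X v : ℕ) : Prop :=
  ∃ h < L, ∃ l < L, l < A 5 (A 4 v) ∧
    X = h * (A 5 (A 4 v) + A 5 (A 4 v)) + (A 5 (A 4 v) + l)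

def HatN (X c v : ℕ) : Prop := v = c ∨ A 3 v ≠ 0 ∧ BitN A L X v

noncomputable def degN (B c z : ℕ) : ℕ :=
  sumN n L (fun i => HatN A L B c i ∧ AdjN A n L z i) fun _ => 1

def PoolN (p c z : ℕ) : Prop := ¬A 3 z ≠ 0 ∧ ¬A 3 p ≠ 0 ∧ ¬AdjN A n L z p ∧ ¬z = c

def AgentN (Y p c z : ℕ) : Prop :=
  HatN A L Y c z ∨ PoolN A n L p c z ∧ ∃ i, (i < n ∧ i < L) ∧ HatN A L Y c i ∧ AdjN A n L i z

open Classical in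
noncomputable def priceN (B p c z : ℕ) : ℕ :=
  if PoolN A n L p c z ∧ ¬A 1 z ≠ 0 then degN A n L B c z - 1 else 0

def cellN (M B c p d X : ℕ) : ℕ :=
  min (min (min (min B L * n + c) L * n + p) L * n + d) L * M + X

end

section

variable {σ : ℕ → ℕ} {A : ℕ → ℕ → ℕ} {x y a b c X v z p d B Y : ℕ}

/-- The register bounds here and below keep the arguments apart from the registers that the helper
terms bind: `27` in `agentT`, `28` in `degT`, and `30` upward in products and bit tests. -/
theorem holds_adjT (hx : x < 30) (_hy : y < 30) :
    (adjT x y).Holds σ A ↔ AdjN A (σ 0) (σ 1) (σ x) (σ y) := by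
  rw [adjT, holds_read, eval, eval_mul (v := σ x) (w := σ 0)]
  · rfl
  · intro i; simp [eval, hx.ne]
  · intro i; simp [eval]

theorem eval_tripleT (ha : a < 30) (hb : b < 30) :
    (tripleT a b c).eval σ A = tripleN (σ 0) (σ 1) (σ a) (σ b) (σ c) := by
  rw [tripleT, eval, eval_mul (v := min (σ a) (σ 1) * σ 0 + σ b) (w := σ 0)]
  · rfl
  · intro i
    rw [eval, eval_mul (v := σ a) (w := σ 0)]
    · simp [eval, hb.ne]
    · intro i; simp [eval, ha.ne, show a ≠ 31 by omega]
    · intro i; simp [eval]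
  · intro i; simp [eval]

theorem eval_cellT (hB : B < 30) (hc : c < 30) (hp : p < 30) (hd : d < 30) :
    (cellT B c p d X).eval σ A =
      cellN (σ 0) (σ 1) (σ 2) (σ B) (σ c) (σ p) (σ d) (σ X) := by
  have e1 : ∀ τ : ℕ → ℕ, (mul 43 (var B) (var 0)).eval τ A = min (τ B) (τ 1) * τ 0 := fun τ =>
    eval_mul (fun i => by simp [eval, show B ≠ 43 by omega]) (fun i => by simp [eval])
  have e2 : ∀ τ : ℕ → ℕ, (mul 42 (add (mul 43 (var B) (var 0)) (var c)) (var 0)).eval τ A =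
      min (min (τ B) (τ 1) * τ 0 + τ c) (τ 1) * τ 0 := fun τ =>
    eval_mul (fun i => by simp [eval, e1, show B ≠ 42 by omega, show c ≠ 42 by omega])
      (fun i => by simp [eval])
  have e3 : ∀ τ : ℕ → ℕ, (mul 41 (add (mul 42 (add (mul 43 (var B) (var 0)) (var c)) (var 0))
      (var p)) (var 0)).eval τ A =
      min (min (min (τ B) (τ 1) * τ 0 + τ c) (τ 1) * τ 0 + τ p) (τ 1) * τ 0 := fun τ =>
    eval_mul (fun i => by simp [eval, e2, show B ≠ 41 by omega, show c ≠ 41 by omega,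
      show p ≠ 41 by omega]) (fun i => by simp [eval])
  rw [cellT, eval, eval_mul (v := min (min (min (σ B) (σ 1) * σ 0 + σ c) (σ 1) * σ 0 + σ p) (σ 1)
    * σ 0 + σ d) (w := σ 2)]
  · rfl
  · intro i
    simp [eval, e3, show B ≠ 40 by omega, show c ≠ 40 by omega, show p ≠ 40 by omega,
      show d ≠ 40 by omega]
  · intro i; simp [eval]

theorem holds_bitT (hX : X < 30) (hv : v < 30) :
    (bitT X v).Holds σ A ↔ BitN A (σ 1) (σ X) (σ v) := by
  have e1 : ∀ τ : ℕ → ℕ, (mul 33 (var 31)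
      (add (read 5 (read 4 (var v))) (read 5 (read 4 (var v))))).eval τ A =
      min (τ 31) (τ 1) * (A 5 (A 4 (τ v)) + A 5 (A 4 (τ v))) := fun τ =>
    eval_mul (fun i => by simp [eval]) (fun i => by simp [eval, show v ≠ 33 by omega])
  rw [bitT, holds_ex (by decide), BitN]
  refine exists_congr fun h => ?_
  rw [and_self]
  refine and_congr_right fun hh => ?_
  rw [holds_ex (by decide)]
  refine exists_congr fun l => ?_
  simp [holds_and, holds_lt, holds_eq, eval, e1, show v ≠ 31 by omega, show v ≠ 32 by omega,
    show X ≠ 31 by omega, show X ≠ 32 by omega, hh.le]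

theorem holds_hatT (hX : X < 30) (hv : v < 30) :
    (hatT X c v).Holds σ A ↔ HatN A (σ 1) (σ X) (σ c) (σ v) := by
  simp only [hatT, holds_or, holds_and, holds_read, holds_bitT hX hv, holds_eq, eval, HatN]

theorem eval_degT (hB : B < 28) (hc : c < 28) (hz : z < 28) :
    (degT B c z).eval σ A = degN A (σ 0) (σ 1) (σ B) (σ c) (σ z) := by
  rw [degT, eval_sumIf (by decide), degN]
  simp [holds_and, holds_hatT, holds_adjT, hB.trans, hz.trans, hB.ne, hc.ne, hz.ne, eval]

theorem holds_degT (hB : B < 28) (hc : c < 28) (hz : z < 28) :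
    (degT B c z).Holds σ A ↔ degN A (σ 0) (σ 1) (σ B) (σ c) (σ z) ≠ 0 := by
  rw [Holds, eval_degT hB hc hz]

theorem holds_poolT (hp : p < 30) (hz : z < 30) :
    (poolT p c z).Holds σ A ↔ PoolN A (σ 0) (σ 1) (σ p) (σ c) (σ z) := by
  simp only [poolT, holds_not, holds_and, holds_read, holds_adjT hz hp, holds_eq, eval, PoolN]

theorem holds_agentT (hY : Y < 27) (hp : p < 27) (hc : c < 27) (hz : z < 27) :
    (agentT Y p c z).Holds σ A ↔ AgentN A (σ 0) (σ 1) (σ Y) (σ p) (σ c) (σ z) := by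
  simp [agentT, holds_or, holds_and, holds_hatT, holds_poolT, holds_ex, holds_adjT, AgentN,
    hY.trans, hp.trans, hz.trans, hY.ne, hc.ne, hz.ne]

theorem eval_priceT (hB : B < 28) (hp : p < 28) (hc : c < 28) (hz : z < 28) :
    (priceT B p c z).eval σ A = priceN A (σ 0) (σ 1) (σ B) (σ p) (σ c) (σ z) := by
  have h : ((poolT p c z).and (read 1 (var z)).not).eval σ A ≠ 0 ↔
      PoolN A (σ 0) (σ 1) (σ p) (σ c) (σ z) ∧ ¬A 1 (σ z) ≠ 0 := by
    refine holds_and.trans ?_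
    simp only [holds_poolT (hp.trans (by decide : 28 < 30)) (hz.trans (by decide : 28 < 30)),
      holds_not, holds_read, eval]
  rw [priceT, eval, priceN, ← eval_degT (σ := σ) (A := A) hB hc hz]
  by_cases hz : PoolN A (σ 0) (σ 1) (σ p) (σ c) (σ z) ∧ ¬A 1 (σ z) ≠ 0
  · rw [if_pos (h.2 hz), if_pos hz]
    rfl
  · rw [if_neg (mt h.1 hz), if_neg hz]
    rfl

end

/-! ### The terms that define the tables and the answer -/

/-- The triple with index in register `3` is bad and disjoint from all triples selected before. -/
def selT : Tm :=
  ex 0 10 (ex 0 11 (ex 0 12 ((eq (var 3) (tripleT 10 11 12)).and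
    (((adjT 10 11).and ((adjT 10 12).not.and ((adjT 11 12).not.and
      ((eq (var 10) (var 12)).not.and (eq (var 11) (var 12)).not)))).and
    (not (ex 0 13 (ex 0 14 (ex 0 15 ((read 2 (tripleT 13 14 15)).and
      ((((eq (var 10) (var 13)).or ((eq (var 10) (var 14)).or (eq (var 10) (var 15)))).or
       ((eq (var 11) (var 13)).or ((eq (var 11) (var 14)).or (eq (var 11) (var 15))))).or
       ((eq (var 12) (var 13)).or ((eq (var 12) (var 14)).or (eq (var 12) (var 15))))))))))))))

/-- The vertex in register `3` lies in a selected triple. -/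
def modT : Tm :=
  ex 0 10 (ex 0 11 (ex 0 12 ((read 2 (tripleT 10 11 12)).and
    ((eq (var 3) (var 10)).or ((eq (var 3) (var 11)).or (eq (var 3) (var 12)))))))

/-- The number of vertices of the modulator below the one in register `3`. -/
def rankT : Tm := sumIf 10 ((lt (var 10) (var 3)).and (read 3 (var 10))) (const 1)

def powT : Tm :=
  .ite (var 3) (add (read 5 (sub (var 3) (const 1))) (read 5 (sub (var 3) (const 1)))) (const 1)

/-- The cell of the table of partial trees with index in register `3`. -/
def growT : Tm :=
  ex 2 10 (ex 0 11 (ex 0 12 (ex 0 13 (ex 2 14 ((eq (var 3) (cellT 10 11 12 13 14)).and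
    ((all 0 15 ((hatT 14 11 15).imp (eq (var 15) (var 11)))).or
    (ex 2 16 (ex 0 17 (ex 0 18 ((read 6 (cellT 10 11 12 18 16)).and ((agentT 16 12 11 17).and
      ((le (add (var 18) (priceT 10 12 11 17)) (var 13)).and
      (all 0 15 ((hatT 14 11 15).imp ((hatT 16 11 15).or
        ((hatT 10 11 15).and (adjT 17 15)))))))))))))))))

/-- For some `B`, `c`, `p`, `d`: the whole base is connected at price `d`, every terminal lies in
the base or the pool, no pool terminal is isolated from the base, and the edge count is that of a
tree. Doublings are written as sums. -/
def acceptT : Tm :=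
  ex 2 10 (ex 0 11 (ex 0 12 (ex 0 13 ((read 6 (cellT 10 11 12 13 10)).and
    ((all 0 15 ((read 1 (var 15)).imp ((hatT 10 11 15).or (poolT 12 11 15)))).and
    ((all 0 15 (((poolT 12 11 15).and (read 1 (var 15))).imp (degT 10 11 15))).and
    (le (add (add (add (var 13) (var 13)) (sumIf 15 (hatT 10 11 15) (degT 10 11 15)))
        (add (add (sumIf 15 ((poolT 12 11 15).and (read 1 (var 15))) (degT 10 11 15))
          (sumIf 15 ((poolT 12 11 15).and (read 1 (var 15))) (degT 10 11 15))) (const 2)))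
      (add (add (sumIf 15 (hatT 10 11 15) (const 1))
          (sumIf 15 ((poolT 12 11 15).and (read 1 (var 15))) (const 1)))
        (add (sumIf 15 (hatT 10 11 15) (const 1))
          (sumIf 15 ((poolT 12 11 15).and (read 1 (var 15))) (const 1)))))))))))

theorem wf_selT : selT.WF 50 := by decide
theorem wf_modT : modT.WF 50 := by decide
theorem wf_rankT : rankT.WF 50 := by decide
theorem wf_powT : powT.WF 50 := by decide
theorem wf_growT : growT.WF 50 := by decide
theorem wf_acceptT : acceptT.WF 50 := by decide

section

variable {σ : ℕ → ℕ} {A : ℕ → ℕ → ℕ}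

theorem holds_selT : selT.Holds σ A ↔
    ∃ a, (a < σ 0 ∧ a < σ 1) ∧ ∃ b, (b < σ 0 ∧ b < σ 1) ∧ ∃ c, (c < σ 0 ∧ c < σ 1) ∧
      σ 3 = tripleN (σ 0) (σ 1) a b c ∧
      (AdjN A (σ 0) (σ 1) a b ∧ ¬AdjN A (σ 0) (σ 1) a c ∧ ¬AdjN A (σ 0) (σ 1) b c ∧ ¬a = c ∧
        ¬b = c) ∧
      ¬∃ a', (a' < σ 0 ∧ a' < σ 1) ∧ ∃ b', (b' < σ 0 ∧ b' < σ 1) ∧ ∃ c', (c' < σ 0 ∧ c' < σ 1) ∧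
        A 2 (tripleN (σ 0) (σ 1) a' b' c') ≠ 0 ∧ (((a = a' ∨ a = b' ∨ a = c') ∨
          b = a' ∨ b = b' ∨ b = c') ∨ c = a' ∨ c = b' ∨ c = c') := by
  simp [selT, holds_ex, holds_and, holds_or, holds_not, holds_eq,
    holds_read, holds_adjT, eval, eval_tripleT, -not_exists, -not_and]

theorem holds_modT : modT.Holds σ A ↔
    ∃ a, (a < σ 0 ∧ a < σ 1) ∧ ∃ b, (b < σ 0 ∧ b < σ 1) ∧ ∃ c, (c < σ 0 ∧ c < σ 1) ∧
      A 2 (tripleN (σ 0) (σ 1) a b c) ≠ 0 ∧ (σ 3 = a ∨ σ 3 = b ∨ σ 3 = c) := by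
  simp [modT, holds_ex, holds_and, holds_or, holds_eq, holds_read, eval, eval_tripleT]

theorem eval_rankT : rankT.eval σ A =
    sumN (σ 0) (σ 1) (fun i => i < σ 3 ∧ A 3 i ≠ 0) fun _ => 1 := by
  simp [rankT, eval_sumIf, holds_and, holds_lt, holds_read, eval]

theorem holds_growT : growT.Holds σ A ↔
    ∃ B, (B < σ 2 ∧ B < σ 1) ∧ ∃ c, (c < σ 0 ∧ c < σ 1) ∧ ∃ p, (p < σ 0 ∧ p < σ 1) ∧
    ∃ d, (d < σ 0 ∧ d < σ 1) ∧ ∃ X, (X < σ 2 ∧ X < σ 1) ∧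
      σ 3 = cellN (σ 0) (σ 1) (σ 2) B c p d X ∧
      ((∀ v, (v < σ 0 ∧ v < σ 1) → HatN A (σ 1) X c v → v = c) ∨
        ∃ Y, (Y < σ 2 ∧ Y < σ 1) ∧ ∃ z, (z < σ 0 ∧ z < σ 1) ∧ ∃ d', (d' < σ 0 ∧ d' < σ 1) ∧
          A 6 (cellN (σ 0) (σ 1) (σ 2) B c p d' Y) ≠ 0 ∧ AgentN A (σ 0) (σ 1) Y p c z ∧
          d' + priceN A (σ 0) (σ 1) B p c z ≤ d ∧
          ∀ v, (v < σ 0 ∧ v < σ 1) → HatN A (σ 1) X c v → HatN A (σ 1) Y c v ∨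
            HatN A (σ 1) B c v ∧ AdjN A (σ 0) (σ 1) z v) := by
  simp [growT, holds_ex, holds_all, holds_and, holds_or, holds_imp, holds_eq, holds_le,
    holds_read, holds_adjT, eval, eval_cellT, holds_agentT, eval_priceT, holds_hatT]

theorem holds_acceptT : acceptT.Holds σ A ↔
    ∃ B, (B < σ 2 ∧ B < σ 1) ∧ ∃ c, (c < σ 0 ∧ c < σ 1) ∧ ∃ p, (p < σ 0 ∧ p < σ 1) ∧
    ∃ d, (d < σ 0 ∧ d < σ 1) ∧ A 6 (cellN (σ 0) (σ 1) (σ 2) B c p d B) ≠ 0 ∧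
      (∀ v, (v < σ 0 ∧ v < σ 1) → A 1 v ≠ 0 → HatN A (σ 1) B c v ∨
        PoolN A (σ 0) (σ 1) p c v) ∧
      (∀ v, (v < σ 0 ∧ v < σ 1) → PoolN A (σ 0) (σ 1) p c v ∧ A 1 v ≠ 0 →
        degN A (σ 0) (σ 1) B c v ≠ 0) ∧
      d + d + sumN (σ 0) (σ 1) (HatN A (σ 1) B c) (degN A (σ 0) (σ 1) B c) +
        (sumN (σ 0) (σ 1) (fun v => PoolN A (σ 0) (σ 1) p c v ∧ A 1 v ≠ 0)
            (degN A (σ 0) (σ 1) B c) +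
          sumN (σ 0) (σ 1) (fun v => PoolN A (σ 0) (σ 1) p c v ∧ A 1 v ≠ 0)
            (degN A (σ 0) (σ 1) B c) + 2) ≤
      sumN (σ 0) (σ 1) (HatN A (σ 1) B c) (fun _ => 1) +
        sumN (σ 0) (σ 1) (fun v => PoolN A (σ 0) (σ 1) p c v ∧ A 1 v ≠ 0) (fun _ => 1) +
      (sumN (σ 0) (σ 1) (HatN A (σ 1) B c) (fun _ => 1) +
        sumN (σ 0) (σ 1) (fun v => PoolN A (σ 0) (σ 1) p c v ∧ A 1 v ≠ 0) (fun _ => 1)) := by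
  simp [acceptT, holds_ex, holds_all, holds_and, holds_or, holds_imp, holds_le, holds_read,
    eval, eval_cellT, holds_poolT, eval_degT, holds_degT, holds_hatT, eval_sumIf]

end

end Tm

end RAM

/-! ### From numbers back to vertices and sets -/

namespace RAM

open Finset Tm

section

variable {n : ℕ}

theorem exists_lt_and_iff {L : ℕ} (h : n ≤ L) {P : ℕ → Prop} :
    (∃ i, (i < n ∧ i < L) ∧ P i) ↔ ∃ i : Fin n, P i :=
  ⟨fun ⟨i, hi, hP⟩ => ⟨⟨i, hi.1⟩, hP⟩, fun ⟨i, hP⟩ => ⟨i, ⟨i.2, i.2.trans_le h⟩, hP⟩⟩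

theorem forall_lt_and_iff {L : ℕ} (h : n ≤ L) {P : ℕ → Prop} :
    (∀ i, i < n ∧ i < L → P i) ↔ ∀ i : Fin n, P i :=
  ⟨fun H i => H i ⟨i.2, i.2.trans_le h⟩, fun H i hi => H ⟨i, hi.1⟩⟩

open Classical in
theorem sumN_eq {L : ℕ} (h : n ≤ L) (P : ℕ → Prop) (f : ℕ → ℕ) :
    sumN n L P f = ∑ i ∈ univ.filter (fun i : Fin n => P i), f i := by
  symm
  rw [sumN]
  refine sum_bij (fun (i : Fin n) _ => (i : ℕ)) ?_ ?_ ?_ ?_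
  · intro i hi
    simpa [i.2.trans_le h] using hi
  · intro i _ j _ hij
    exact Fin.ext hij
  · intro i hi
    simp only [mem_filter, mem_range] at hi
    exact ⟨⟨i, hi.2.1⟩, by simpa using hi.2.2, rfl⟩
  · intro i _
    rfl

theorem mul_add_lt_mul {a b P N : ℕ} (ha : a < P) (hb : b < N) : a * N + b < P * N :=
  calc a * N + b < a * N + N := by omega
    _ = (a + 1) * N := by ring
    _ ≤ P * N := Nat.mul_le_mul_right _ ha

theorem mul_add_inj {a a' b b' N : ℕ} (hb : b < N) (hb' : b' < N) (h : a * N + b = a' * N + b') :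
    a = a' ∧ b = b' := by
  have h1 : (a * N + b) / N = (a' * N + b') / N := by rw [h]
  have hN : 0 < N := by omega
  rw [mul_comm a, mul_comm a', Nat.mul_add_div hN, Nat.mul_add_div hN, Nat.div_eq_of_lt hb,
    Nat.div_eq_of_lt hb'] at h1
  have : a = a' := by omega
  subst this
  omega

theorem testBit_eq_true_iff {X i : ℕ} :
    X.testBit i = true ↔ ∃ h l, l < 2 ^ i ∧ X = h * (2 ^ i + 2 ^ i) + (2 ^ i + l) := by
  have hpos : 0 < 2 ^ i := by positivity
  rw [Nat.testBit_eq_decide_div_mod_eq, decide_eq_true_iff]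
  constructor
  · intro h
    refine ⟨X / 2 ^ i / 2, X % 2 ^ i, Nat.mod_lt _ hpos, ?_⟩
    have h1 := Nat.div_add_mod X (2 ^ i)
    have h2 := Nat.div_add_mod (X / 2 ^ i) 2
    rw [h] at h2
    calc X = 2 ^ i * (2 * (X / 2 ^ i / 2) + 1) + X % 2 ^ i := by rw [h2, h1]
      _ = _ := by ring
  · rintro ⟨h, l, hl, rfl⟩
    have : h * (2 ^ i + 2 ^ i) + (2 ^ i + l) = 2 ^ i * (2 * h + 1) + l := by ring
    rw [this, Nat.mul_add_div hpos, Nat.div_eq_of_lt hl]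
    omega

/-- The arrays `A` hold the graph, the terminals, a modulator `U`, the rank of its elements, and
the powers of two. -/
structure Setup (G : SimpleGraph (Fin n)) (K U : Finset (Fin n)) (A : ℕ → ℕ → ℕ) (L m : ℕ) :
    Prop where
  n_le : n ≤ L
  adj : ∀ i j : Fin n, A 0 (i * n + j) ≠ 0 ↔ G.Adj i j
  term : ∀ i : Fin n, A 1 i ≠ 0 ↔ i ∈ K
  mod : ∀ i : Fin n, A 3 i ≠ 0 ↔ i ∈ U
  rank_lt : ∀ i ∈ U, A 4 (i : Fin n) < m
  rank_inj : ∀ i ∈ U, ∀ j ∈ U, A 4 (i : Fin n) = A 4 (j : Fin n) → i = j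
  pow : ∀ i ≤ m, A 5 i = 2 ^ i
  size : 2 ^ m * n * n * n * 2 ^ m ≤ L

/-- The set of vertices with mask `X`, together with `c`. -/
def hat (U : Finset (Fin n)) (A : ℕ → ℕ → ℕ) (X : ℕ) (c : Fin n) : Finset (Fin n) :=
  {v | v = c ∨ v ∈ U ∧ X.testBit (A 4 v) = true}

namespace Setup

variable {G : SimpleGraph (Fin n)} {K U : Finset (Fin n)} {A : ℕ → ℕ → ℕ} {L m : ℕ}

/-- Array `6` holds the table of partial trees, which `Setup` does not mention, so all decodings
survive while it is being filled. -/
theorem update_six (h : Setup G K U A L m) (f : ℕ → ℕ) :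
    Setup G K U (Function.update A 6 f) L m where
  n_le := h.n_le
  adj := by simpa using h.adj
  term := by simpa using h.term
  mod := by simpa using h.mod
  rank_lt := by simpa using h.rank_lt
  rank_inj := by simpa using h.rank_inj
  pow := by simpa using h.pow
  size := h.size

/-- A vertex is needed because the field `size` is void when `n = 0`. -/
theorem pow_le (h : Setup G K U A L m) (i : Fin n) : 2 ^ m ≤ L := by
  refine le_trans ?_ h.size
  have : 0 < n := i.pos
  exact Nat.le_mul_of_pos_left _ (by positivity)

theorem adjN_iff (h : Setup G K U A L m) (i j : Fin n) : AdjN A n L i j ↔ G.Adj i j := by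
  rw [AdjN, min_eq_left (i.2.le.trans h.n_le), h.adj]

theorem bitN_iff (h : Setup G K U A L m) {X : ℕ} (hX : X < 2 ^ m) {v : Fin n} (hv : v ∈ U) :
    BitN A L X v ↔ X.testBit (A 4 v) = true := by
  have hXL := hX.trans_le (h.pow_le v)
  have hpos : 0 < 2 ^ A 4 v := by positivity
  rw [BitN, testBit_eq_true_iff, h.pow _ (h.rank_lt v hv).le]
  constructor
  · rintro ⟨a, -, l, -, hl, hX⟩
    exact ⟨a, l, hl, hX⟩
  · rintro ⟨a, l, hl, hX⟩
    refine ⟨a, ?_, l, by omega, hl, hX⟩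
    have : a * 1 ≤ a * (2 ^ A 4 v + 2 ^ A 4 v) := Nat.mul_le_mul_left _ (by omega)
    omega

theorem hatN_iff (h : Setup G K U A L m) {X : ℕ} (hX : X < 2 ^ m) (c v : Fin n) :
    HatN A L X c v ↔ v ∈ hat U A X c := by
  simp only [HatN, hat, mem_filter, mem_univ, true_and, h.mod, Fin.val_inj]
  exact or_congr_right (and_congr_right fun hv => h.bitN_iff hX hv)

theorem degN_eq (h : Setup G K U A L m) {B : ℕ} (hB : B < 2 ^ m) (c z : Fin n) :
    degN A n L B c z = degIn G (hat U A B c) z := by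
  classical
  rw [degN, sumN_eq h.n_le, ← card_eq_sum_ones, degIn]
  refine congrArg card ?_
  ext i
  simp [h.hatN_iff hB, h.adjN_iff]

theorem poolN_iff (h : Setup G K U A L m) (p c z : Fin n) :
    PoolN A n L p c z ↔ z ∈ poolOf G U p c := by
  simp only [PoolN, poolOf, mem_filter, mem_univ, true_and, h.mod, h.adjN_iff, Fin.val_inj, ne_eq]

theorem agentN_iff (h : Setup G K U A L m) {Y : ℕ} (hY : Y < 2 ^ m) (p c z : Fin n) :
    AgentN A n L Y p c z ↔ IsAgent G (poolOf G U p c) (hat U A Y c) z := by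
  simp only [AgentN, IsAgent, h.hatN_iff hY, h.poolN_iff, exists_lt_and_iff h.n_le, h.adjN_iff]

theorem priceN_eq (h : Setup G K U A L m) {B : ℕ} (hB : B < 2 ^ m) (p c z : Fin n) :
    priceN A n L B p c z = price G (hat U A B c) (poolOf G U p c) K z := by
  simp only [priceN, price, h.poolN_iff, h.degN_eq hB, h.term]

theorem cell_lt (h : Setup G K U A L m) {B X : ℕ} (hB : B < 2 ^ m) (hX : X < 2 ^ m)
    (c p d : Fin n) : (((B * n + c) * n + p) * n + d) * 2 ^ m + X < L :=
  (mul_add_lt_mul (mul_add_lt_mul (mul_add_lt_mul (mul_add_lt_mul hB c.2) p.2) d.2) hX).trans_le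
    h.size

/-- All intermediate factors are at most the index of a genuine cell, hence below `L`, so no product
saturates. -/
theorem cellN_eq (h : Setup G K U A L m) {B X : ℕ} (hB : B < 2 ^ m) (c p d : Fin n) :
    cellN n L (2 ^ m) B c p d X = (((B * n + c) * n + p) * n + d) * 2 ^ m + X := by
  have hn : 1 ≤ n := c.pos
  have hm : 1 ≤ 2 ^ m := Nat.one_le_two_pow
  have h3 := (mul_add_lt_mul (mul_add_lt_mul (mul_add_lt_mul hB c.2) p.2) d.2).le
  have h4 := h.cell_lt hB (X := 0) (by positivity) c p d
  have hle : ∀ a b k : ℕ, 1 ≤ k → a ≤ a * k + b := fun a b k hk =>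
    (Nat.le_mul_of_pos_right a hk).trans (Nat.le_add_right _ _)
  have e4 := (hle (((B * n + c) * n + p) * n + d) 0 _ hm).trans h4.le
  have e3 := (hle ((B * n + c) * n + p) d _ hn).trans e4
  have e2 := (hle (B * n + c) p _ hn).trans e3
  have e1 := (hle B c _ hn).trans e2
  rw [cellN, min_eq_left e1, min_eq_left e2, min_eq_left e3, min_eq_left e4]

end Setup

end

end RAM

/-! ### Correctness of the table of partial trees -/

namespace RAM

open Finset Tm

section

variable {n : ℕ} {G : SimpleGraph (Fin n)} {K U : Finset (Fin n)} {A : ℕ → ℕ → ℕ} {L m : ℕ}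
  {σ : ℕ → ℕ}

/-- The index of a cell in the table of partial trees. -/
def cell (n m B : ℕ) (c p d : Fin n) (X : ℕ) : ℕ := (((B * n + c) * n + p) * n + d) * 2 ^ m + X

theorem cell_inj {B B' X X' : ℕ} {c c' p p' d d' : Fin n} (hX : X < 2 ^ m) (hX' : X' < 2 ^ m)
    (h : cell n m B c p d X = cell n m B' c' p' d' X') :
    B = B' ∧ c = c' ∧ p = p' ∧ d = d' ∧ X = X' := by
  obtain ⟨h1, hX⟩ := mul_add_inj hX hX' h
  obtain ⟨h2, hd⟩ := mul_add_inj d.2 d'.2 h1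
  obtain ⟨h3, hp⟩ := mul_add_inj p.2 p'.2 h2
  obtain ⟨h4, hc⟩ := mul_add_inj c.2 c'.2 h3
  exact ⟨h4, Fin.ext hc, Fin.ext hp, Fin.ext hd, hX⟩

-- The defining recurrence of the table. Cells not yet filled read as zero because array `6` starts
-- empty, so only predecessors with smaller index count.
open Classical in
theorem table_growT_ne_zero_iff (h : Setup G K U A L m) (h0 : σ 0 = n) (h1 : σ 1 = L)
    (h2 : σ 2 = 2 ^ m) (hA : A 6 = 0) {B X : ℕ} (hB : B < 2 ^ m) (hX : X < 2 ^ m)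
    (c p d : Fin n) : growT.table 6 σ A (cell n m B c p d X) ≠ 0 ↔
      hat U A X c ⊆ {c} ∨ ∃ Y < 2 ^ m, ∃ z d' : Fin n,
        cell n m B c p d' Y < cell n m B c p d X ∧
        growT.table 6 σ A (cell n m B c p d' Y) ≠ 0 ∧
        IsAgent G (poolOf G U p c) (hat U A Y c) z ∧
        d' + price G (hat U A B c) (poolOf G U p c) K z ≤ d ∧
        hat U A X c ⊆ hat U A Y c ∪ {v ∈ hat U A B c | G.Adj z v} := by
  have hL := h.pow_le c
  have hML : ∀ i, (i < 2 ^ m ∧ i < L) ↔ i < 2 ^ m := fun i => ⟨And.left, fun hi => ⟨hi, by omega⟩⟩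
  rw [table]
  simp only [dite_eq_ite]
  set i := cell n m B c p d X with hi
  set T := growT.table 6 σ A
  set A' := Function.update A 6 fun j => if j < i then T j else A 6 j with hA'
  have h' : Setup G K U A' L m := h.update_six _
  have hhat : ∀ X c, hat U A' X c = hat U A X c := fun X c => by simp [hat, hA']
  have hA6 : ∀ j, A' 6 j ≠ 0 ↔ j < i ∧ T j ≠ 0 := fun j => by simp [hA', hA]
  refine holds_growT.trans ?_
  simp only [Function.update_self, ne_eq, OfNat.zero_ne_ofNat, not_false_eq_true,
    Function.update_of_ne, OfNat.one_ne_ofNat, Nat.reduceEqDiff, h0, h1, h2, hML,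
    exists_lt_and_iff h.n_le, forall_lt_and_iff h.n_le]
  have hcov : ∀ {B X Y : ℕ} (hB : B < 2 ^ m) (hX : X < 2 ^ m) (hY : Y < 2 ^ m) (c z : Fin n),
      (∀ v : Fin n, HatN A' L X c v → HatN A' L Y c v ∨ HatN A' L B c v ∧ AdjN A' n L z v) ↔
      hat U A X c ⊆ hat U A Y c ∪ {v ∈ hat U A B c | G.Adj z v} := fun hB hX hY c z => by
    simp only [h'.hatN_iff hB, h'.hatN_iff hX, h'.hatN_iff hY, hhat, h'.adjN_iff, subset_iff,
      mem_union, mem_filter]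
  have hbase : ∀ {X : ℕ} (hX : X < 2 ^ m) (c : Fin n),
      (∀ v : Fin n, HatN A' L X c v → (v : ℕ) = c) ↔ hat U A X c ⊆ {c} := fun hX c => by
    simp only [h'.hatN_iff hX, hhat, subset_iff, mem_singleton, Fin.val_inj]
  constructor
  · rintro ⟨B₁, hB₁, c₁, p₁, d₁, X₁, hX₁, hc, hor⟩
    rw [h'.cellN_eq hB₁] at hc
    obtain ⟨rfl, rfl, rfl, rfl, rfl⟩ := cell_inj hX hX₁ (hi.symm.trans hc)
    refine hor.imp (hbase hX c).1 ?_
    rintro ⟨Y, hY, z, d', hT, hz, hd, hsub⟩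
    rw [h'.cellN_eq hB] at hT
    obtain ⟨hlt, hT⟩ := (hA6 _).1 hT
    rw [h'.agentN_iff hY, hhat] at hz
    rw [h'.priceN_eq hB, hhat] at hd
    exact ⟨Y, hY, z, d', hlt, hT, hz, hd, (hcov hB hX hY c z).1 hsub⟩
  · intro hor
    refine ⟨B, hB, c, p, d, X, hX, by rw [h'.cellN_eq hB]; rfl, hor.imp (hbase hX c).2 ?_⟩
    rintro ⟨Y, hY, z, d', hlt, hT, hz, hd, hsub⟩
    refine ⟨Y, hY, z, d', ?_, ?_, ?_, (hcov hB hX hY c z).2 hsub⟩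
    · rw [h'.cellN_eq hB]
      exact (hA6 _).2 ⟨hlt, hT⟩
    · rw [h'.agentN_iff hY, hhat]; exact hz
    · rw [h'.priceN_eq hB, hhat]; exact hd

/-- Predecessors have smaller index, so strong induction on the index unwinds a nonzero cell into a
derivation. -/
theorem grow_of_table (h : Setup G K U A L m) (h0 : σ 0 = n) (h1 : σ 1 = L)
    (h2 : σ 2 = 2 ^ m) (hA : A 6 = 0) {B : ℕ} (hB : B < 2 ^ m) (c p : Fin n) (k : ℕ) :
    ∀ X < 2 ^ m, ∀ d : Fin n, cell n m B c p d X = k →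
      growT.table 6 σ A (cell n m B c p d X) ≠ 0 →
      Grow G (hat U A B c) (poolOf G U p c) K c (hat U A X c) d := by
  induction k using Nat.strong_induction_on with
  | _ k ih =>
  intro X hX d hk hT
  rcases (table_growT_ne_zero_iff h h0 h1 h2 hA hB hX c p d).1 hT with hb |
    ⟨Y, hY, z, d', hlt, hT', hz, hd, hsub⟩
  · exact .base hb
  · refine .step (ih _ (hk ▸ hlt) Y hY d' rfl hT') hz hd ?_
    exact hsub

open Classical in
/-- The mask of the set `Z ∩ U`. -/
noncomputable def mask (U : Finset (Fin n)) (A : ℕ → ℕ → ℕ) (m : ℕ) (Z : Finset (Fin n)) : ℕ :=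
  Nat.ofBits fun i : Fin m => decide (∃ v ∈ Z, v ∈ U ∧ A 4 v = i)

theorem mask_lt (Z : Finset (Fin n)) : mask U A m Z < 2 ^ m := Nat.ofBits_lt_two_pow _

theorem testBit_mask {Z : Finset (Fin n)} {i : ℕ} :
    (mask U A m Z).testBit i = true ↔ i < m ∧ ∃ v ∈ Z, v ∈ U ∧ A 4 v = i := by
  by_cases hi : i < m
  · simp [mask, Nat.testBit_ofBits_lt _ _ hi, hi]
  · simp [mask, Nat.testBit_ofBits_ge _ _ (not_lt.1 hi), hi]

theorem hat_mask (h : Setup G K U A L m) {Z : Finset (Fin n)} {c : Fin n} (hc : c ∈ Z)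
    (hZ : ∀ v ∈ Z, v ∈ U ∨ v = c) : hat U A (mask U A m Z) c = Z := by
  ext v
  simp only [hat, mem_filter, mem_univ, true_and, testBit_mask]
  constructor
  · rintro (rfl | ⟨hv, -, w, hw, hwU, hvw⟩)
    · exact hc
    · rwa [← h.rank_inj w hwU v hv hvw]
  · intro hv
    by_cases hvc : v = c
    · exact Or.inl hvc
    · have hvU := (hZ v hv).resolve_right hvc
      exact Or.inr ⟨hvU, h.rank_lt v hvU, v, hv, hvU, rfl⟩

theorem mask_mono {Y Z : Finset (Fin n)} (hYZ : Y ⊆ Z) : mask U A m Y ≤ mask U A m Z := by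
  have : mask U A m Y = mask U A m Y &&& mask U A m Z := by
    refine Nat.eq_of_testBit_eq fun i => ?_
    rw [Nat.testBit_and, Bool.eq_iff_iff, Bool.and_eq_true, testBit_mask, testBit_mask]
    exact ⟨fun ⟨hi, v, hv, hh⟩ => ⟨⟨hi, v, hv, hh⟩, hi, v, hYZ hv, hh⟩, And.left⟩
  rw [this]
  exact Nat.and_le_right

/-- Masks are monotone, and together with `c` a mask determines its set; hence a strictly larger set
has a strictly larger mask. -/
theorem mask_lt_mask (h : Setup G K U A L m) {Y Z : Finset (Fin n)} {c : Fin n} (hc : c ∈ Y)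
    (hYZ : Y ⊂ Z) (hZ : ∀ v ∈ Z, v ∈ U ∨ v = c) : mask U A m Y < mask U A m Z := by
  refine lt_of_le_of_ne (mask_mono hYZ.1) fun he => hYZ.ne ?_
  rw [← hat_mask h hc fun v hv => hZ v (hYZ.1 hv), ← hat_mask h (hYZ.1 hc) hZ, he]

theorem disjoint_hat_poolOf (B : ℕ) (c p : Fin n) :
    Disjoint (hat U A B c) (poolOf G U p c) := by
  rw [disjoint_left]
  intro v hv hp
  simp only [hat, poolOf, mem_filter, mem_univ, true_and] at hv hp
  rcases hv with hv | hv
  · exact hp.2.2.2 hv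
  · exact hp.1 hv.1

theorem table_of_isTree (h : Setup G K U A L m) (h0 : σ 0 = n) (h1 : σ 1 = L)
    (h2 : σ 2 = 2 ^ m) (hA : A 6 = 0)
    (hU : ∀ a ∉ U, ∀ b ∉ U, ∀ c ∉ U, ¬IsBadTriple G a b c) {S : Finset (Fin n)} (hK : K ⊆ S)
    (hS : (G.induce (S : Set (Fin n))).IsTree) : ∃ B < 2 ^ m, ∃ c p d : Fin n,
      growT.table 6 σ A (cell n m B c p d B) ≠ 0 ∧ K ⊆ hat U A B c ∪ poolOf G U p c ∧
      (∀ t ∈ poolOf G U p c ∩ K, degIn G (hat U A B c) t ≠ 0) ∧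
      2 * d + ∑ x ∈ hat U A B c, degIn G (hat U A B c) x +
        2 * ∑ t ∈ poolOf G U p c ∩ K, degIn G (hat U A B c) t + 2 ≤
        2 * (#(hat U A B c) + #(poolOf G U p c ∩ K)) := by
  classical
  obtain ⟨c, hc, p, hp⟩ := exists_center hU hS
  set Z := insert c (S ∩ U) with hZ
  have hcZ : c ∈ Z := mem_insert_self _ _
  have hZU : ∀ v ∈ Z, v ∈ U ∨ v = c := by
    intro v hv
    rcases mem_insert.1 hv with rfl | hv
    · exact Or.inr rfl
    · exact Or.inl (mem_inter.1 hv).2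
  set B := mask U A m Z with hBdef
  have hB : B < 2 ^ m := mask_lt Z
  have hhat : hat U A B c = Z := hat_mask h hcZ hZU
  have hdisj := disjoint_hat_poolOf (G := G) (U := U) (A := A) B c p
  rw [hhat] at hdisj
  have hZS : Z ⊆ S := insert_subset hc inter_subset_left
  have hSZ : S ⊆ Z ∪ poolOf G U p c := by
    intro v hv
    by_cases hvc : v = c
    · simp [hvc, hcZ]
    by_cases hvU : v ∈ U
    · exact mem_union_left _ (mem_insert_of_mem (mem_inter.2 ⟨hv, hvU⟩))
    · exact mem_union_right _ (hp v hv hvU hvc)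
  have hSn : #S ≤ n := by simpa using card_le_univ S
  obtain ⟨hdeg, d, ⟨hd, -, hT⟩, hle⟩ := exists_grow_of_isTree hS hcZ hdisj
    (not_adj_of_mem_poolOf hU) hZS hSZ hK
    -- The growth is carried out directly in the table: a partial tree counts as found when its cell
    -- is nonzero.
    (fun Y d => ∃ hd : d < n, Y ⊆ Z ∧
      growT.table 6 σ A (cell n m B c p ⟨d, hd⟩ (mask U A m Y)) ≠ 0)
    ⟨c.pos, by simpa using hcZ, by
      refine (table_growT_ne_zero_iff h h0 h1 h2 hA hB (mask_lt _) c p _).2 (Or.inl ?_)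
      rw [hat_mask h (mem_singleton_self c) fun v hv => Or.inr (mem_singleton.1 hv)]⟩ (by
      rintro Y d z ⟨hd, -, hT⟩ hcY hYZ hz hss hle
      -- The price plus one is at most `#S ≤ n`, so prices below `n` suffice as indices.
      have hd' : d + price G Z (poolOf G U p c) K z < n := by omega
      have hsub : Y ∪ {v ∈ Z | G.Adj z v} ⊆ Z := union_subset hYZ (filter_subset _ _)
      refine ⟨hd', hsub, (table_growT_ne_zero_iff h h0 h1 h2 hA hB (mask_lt _) c p _).2
        (Or.inr ⟨mask U A m Y, mask_lt _, z, ⟨d, hd⟩, ?_, hT, ?_, ?_, ?_⟩)⟩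
      -- The price does not drop and the mask, which is the least significant digit, strictly grows,
      -- so the predecessor cell was filled earlier.
      · have hlt := mask_lt_mask h hcY hss fun v hv => hZU v (hsub hv)
        have : (((B * n + c) * n + p) * n + d) * 2 ^ m ≤ (((B * n + c) * n + p) * n +
          (d + price G Z (poolOf G U p c) K z)) * 2 ^ m := Nat.mul_le_mul_right _ (by omega)
        simp only [cell]
        omega
      · rwa [hat_mask h hcY fun v hv => hZU v (hYZ hv)]
      · rw [hhat]
      · rw [hat_mask h (mem_union_left _ hcY) fun v hv => hZU v (hsub hv),
          hat_mask h hcY fun v hv => hZU v (hYZ hv), hhat])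
  refine ⟨B, hB, c, p, ⟨d, hd⟩, hT, ?_⟩
  rw [hhat]
  refine ⟨hK.trans hSZ, ?_, ?_⟩
  · convert hdeg
  · convert hle

theorem holds_acceptT_iff (h : Setup G K U A L m) (h0 : σ 0 = n) (h1 : σ 1 = L)
    (h2 : σ 2 = 2 ^ m) (hA : A 6 = 0)
    (hU : ∀ a ∉ U, ∀ b ∉ U, ∀ c ∉ U, ¬IsBadTriple G a b c) {τ : ℕ → ℕ} (h0' : τ 0 = n)
    (h1' : τ 1 = L) (h2' : τ 2 = 2 ^ m) :
    acceptT.Holds τ (Function.update A 6 fun j => if j < L then growT.table 6 σ A j else A 6 j) ↔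
      HasInducedTreeContaining G K := by
  classical
  set A' := Function.update A 6 fun j => if j < L then growT.table 6 σ A j else A 6 j with hA'
  have h' : Setup G K U A' L m := h.update_six _
  have hhat : ∀ X c, hat U A' X c = hat U A X c := fun X c => by simp [hat, hA']
  have hsum : ∀ (c p : Fin n) (f : ℕ → ℕ),
      sumN n L (fun v => PoolN A' n L p c v ∧ A' 1 v ≠ 0) f =
        ∑ v ∈ poolOf G U p c ∩ K, f v := by
    intro c p f
    rw [sumN_eq h.n_le]
    refine Finset.sum_congr ?_ fun _ _ => rfl
    ext v
    simp only [h'.poolN_iff, h'.term, mem_filter, mem_univ, true_and, mem_inter]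
  have hsum' : ∀ {B : ℕ} (hB : B < 2 ^ m) (c : Fin n) (f : ℕ → ℕ),
      sumN n L (HatN A' L B c) f = ∑ v ∈ hat U A B c, f v := by
    intro B hB c f
    rw [sumN_eq h.n_le]
    refine Finset.sum_congr ?_ fun _ _ => rfl
    ext v
    simp only [h'.hatN_iff hB, hhat, mem_filter, mem_univ, true_and]
  have hiff : ∀ {B : ℕ} (hB : B < 2 ^ m) (c p d : Fin n),
      (A' 6 (cellN n L (2 ^ m) B c p d B) ≠ 0 ∧
      (∀ v : Fin n, A' 1 v ≠ 0 → HatN A' L B c v ∨ PoolN A' n L p c v) ∧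
      (∀ v : Fin n, PoolN A' n L p c v ∧ A' 1 v ≠ 0 → degN A' n L B c v ≠ 0) ∧
      d + d + sumN n L (HatN A' L B c) (degN A' n L B c) +
        (sumN n L (fun v => PoolN A' n L p c v ∧ A' 1 v ≠ 0) (degN A' n L B c) +
          sumN n L (fun v => PoolN A' n L p c v ∧ A' 1 v ≠ 0) (degN A' n L B c) + 2) ≤
      sumN n L (HatN A' L B c) (fun _ => 1) +
        sumN n L (fun v => PoolN A' n L p c v ∧ A' 1 v ≠ 0) (fun _ => 1) +
      (sumN n L (HatN A' L B c) (fun _ => 1) +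
        sumN n L (fun v => PoolN A' n L p c v ∧ A' 1 v ≠ 0) (fun _ => 1))) ↔
      growT.table 6 σ A (cell n m B c p d B) ≠ 0 ∧ K ⊆ hat U A B c ∪ poolOf G U p c ∧
      (∀ t ∈ poolOf G U p c ∩ K, degIn G (hat U A B c) t ≠ 0) ∧
      2 * d + ∑ x ∈ hat U A B c, degIn G (hat U A B c) x +
        2 * ∑ t ∈ poolOf G U p c ∩ K, degIn G (hat U A B c) t + 2 ≤
        2 * (#(hat U A B c) + #(poolOf G U p c ∩ K)) := by
    intro B hB c p d
    have hcell : A' 6 (cellN n L (2 ^ m) B c p d B) = growT.table 6 σ A (cell n m B c p d B) := by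
      rw [h'.cellN_eq hB, hA', Function.update_self, if_pos (h.cell_lt hB hB c p d)]
      rfl
    rw [hcell]
    refine and_congr_right fun _ => and_congr ?_ (and_congr ?_ ?_)
    · simp only [h'.term, h'.hatN_iff hB, hhat, h'.poolN_iff, subset_iff, mem_union]
    · simp only [h'.term, h'.poolN_iff, h'.degN_eq hB, hhat, mem_inter]
    · simp only [hsum, hsum' hB, h'.degN_eq hB, hhat, ← card_eq_sum_ones]
      constructor <;> intro _ <;> omega
  rw [holds_acceptT]
  simp only [h0', h1', h2', exists_lt_and_iff h.n_le, forall_lt_and_iff h.n_le]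
  constructor
  · rintro ⟨B, ⟨hB, -⟩, c, p, d, hh⟩
    obtain ⟨hT, hK, hdeg, hle⟩ := (hiff hB c p d).1 hh
    refine hasInducedTreeContaining_of_grow (c := c) (by simp [hat]) (disjoint_hat_poolOf B c p)
      (not_adj_of_mem_poolOf hU) ?_ ?_ (grow_of_table h h0 h1 h2 hA hB c p _ B hB d rfl hT) ?_
    · convert hK
    · convert hdeg
    · convert hle
  · rintro ⟨S, hKS, hS⟩
    obtain ⟨B, hB, c, p, d, hh⟩ := table_of_isTree h h0 h1 h2 hA hU (S := S.toFinset)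
      (fun x hx => Set.mem_toFinset.2 (hKS hx)) (by rwa [Set.coe_toFinset])
    refine ⟨B, ⟨hB, hB.trans_le (h.pow_le c)⟩, c, p, d, (hiff hB c p d).2 ?_⟩
    convert hh

end

end RAM

/-! ### The greedy packing, the ranks and the powers of two -/

namespace RAM

open Finset Tm

section

variable {n L : ℕ} {G : SimpleGraph (Fin n)} {σ : ℕ → ℕ} {A : ℕ → ℕ → ℕ}

/-- The index of a triple of vertices. -/
def code (x : Fin n × Fin n × Fin n) : ℕ := (x.1 * n + x.2.1) * n + x.2.2

theorem code_injective : Function.Injective (code (n := n)) := by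
  rintro ⟨a, b, c⟩ ⟨a', b', c'⟩ h
  obtain ⟨h1, hc⟩ := mul_add_inj c.2 c'.2 h
  obtain ⟨h2, hb⟩ := mul_add_inj b.2 b'.2 h1
  rw [show a = a' from Fin.ext h2, show b = b' from Fin.ext hb, show c = c' from Fin.ext hc]

theorem code_lt (hL : n * n * n ≤ L) (x : Fin n × Fin n × Fin n) : code x < L :=
  (mul_add_lt_mul (mul_add_lt_mul x.1.2 x.2.1.2) x.2.2.2).trans_le hL

theorem tripleN_eq (hL : n * n * n ≤ L) (a b c : Fin n) :
    tripleN n L a b c = code (a, b, c) := by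
  have hn : 1 ≤ n := a.pos
  have h1 := (code_lt hL (a, b, c)).le
  have hle : ∀ a b k : ℕ, 1 ≤ k → a ≤ a * k + b := fun a b k hk =>
    (Nat.le_mul_of_pos_right a hk).trans (Nat.le_add_right _ _)
  have e2 := (hle (a * n + b) c _ hn).trans h1
  have e1 := (hle a b _ hn).trans e2
  rw [tripleN, min_eq_left e1, min_eq_left e2]
  rfl

/-- Two triples with a common vertex. -/
def Meets (x y : Fin n × Fin n × Fin n) : Prop :=
  ((x.1 = y.1 ∨ x.1 = y.2.1 ∨ x.1 = y.2.2) ∨ x.2.1 = y.1 ∨ x.2.1 = y.2.1 ∨ x.2.1 = y.2.2) ∨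
    x.2.2 = y.1 ∨ x.2.2 = y.2.1 ∨ x.2.2 = y.2.2

theorem Meets.symm {x y : Fin n × Fin n × Fin n} (h : Meets x y) : Meets y x := by
  unfold Meets at *; grind

theorem adjN_iff_adj (hnL : n ≤ L) (hA : ∀ i j : Fin n, A 0 (i * n + j) ≠ 0 ↔ G.Adj i j)
    (i j : Fin n) : AdjN A n L i j ↔ G.Adj i j := by
  rw [AdjN, min_eq_left (i.2.le.trans hnL), hA]

/-- Greedy choice in the order of the codes: a bad triple is selected unless it meets one selected
before it. -/
theorem table_selT_ne_zero_iff (h0 : σ 0 = n) (h1 : σ 1 = L) (hnL : n ≤ L)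
    (hL : n * n * n ≤ L) (hadj : ∀ i j : Fin n, A 0 (i * n + j) ≠ 0 ↔ G.Adj i j) (hA : A 2 = 0)
    (x : Fin n × Fin n × Fin n) : selT.table 2 σ A (code x) ≠ 0 ↔
      IsBadTriple G x.1 x.2.1 x.2.2 ∧
        ¬∃ y, code y < code x ∧ selT.table 2 σ A (code y) ≠ 0 ∧ Meets x y := by
  rw [table]
  simp only [dite_eq_ite]
  set i := code x with hi
  set T := selT.table 2 σ A
  set A' := Function.update A 2 fun j => if j < i then T j else A 2 j with hA'
  have hadj' : ∀ i j : Fin n, A' 0 (i * n + j) ≠ 0 ↔ G.Adj i j := by simpa [hA'] using hadj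
  have hA2 : ∀ j, A' 2 j ≠ 0 ↔ j < i ∧ T j ≠ 0 := fun j => by simp [hA', hA]
  refine holds_selT.trans ?_
  simp only [Function.update_self, ne_eq, OfNat.zero_ne_ofNat, not_false_eq_true,
    Function.update_of_ne, OfNat.one_ne_ofNat, h0, h1, exists_lt_and_iff hnL, tripleN_eq hL,
    adjN_iff_adj hnL hadj', Fin.val_inj]
  have hmeet : ∀ x : Fin n × Fin n × Fin n, (∃ a' b' c' : Fin n, ¬A' 2 (code (a', b', c')) = 0 ∧
      (((x.1 = a' ∨ x.1 = b' ∨ x.1 = c') ∨ x.2.1 = a' ∨ x.2.1 = b' ∨ x.2.1 = c') ∨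
        x.2.2 = a' ∨ x.2.2 = b' ∨ x.2.2 = c')) ↔
      ∃ y, code y < i ∧ T (code y) ≠ 0 ∧ Meets x y := fun x => by
    constructor
    · rintro ⟨a, b, c, h, hm⟩
      exact ⟨(a, b, c), ((hA2 _).1 h).1, ((hA2 _).1 h).2, hm⟩
    · rintro ⟨⟨a, b, c⟩, h, h', hm⟩
      exact ⟨a, b, c, (hA2 _).2 ⟨h, h'⟩, hm⟩
  constructor
  · rintro ⟨a, b, c, hc, hbad, hn⟩
    obtain rfl : x = (a, b, c) := code_injective (hi.symm.trans hc)
    exact ⟨hbad, mt (hmeet (a, b, c)).2 hn⟩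
  · rintro ⟨hbad, hn⟩
    exact ⟨x.1, x.2.1, x.2.2, rfl, hbad, mt (hmeet x).1 hn⟩

/-- The vertices of the triples selected in the table `T`. -/
noncomputable def selected (T : ℕ → ℕ) : Finset (Fin n) :=
  open Classical in {v | ∃ x, T (code x) ≠ 0 ∧ (v = x.1 ∨ v = x.2.1 ∨ v = x.2.2)}

theorem mem_selected {T : ℕ → ℕ} {v : Fin n} :
    v ∈ selected T ↔ ∃ x, T (code x) ≠ 0 ∧ (v = x.1 ∨ v = x.2.1 ∨ v = x.2.2) := by
  simp [selected]

section

variable {T : ℕ → ℕ} (hT : ∀ x, T (code x) ≠ 0 ↔ IsBadTriple G x.1 x.2.1 x.2.2 ∧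
  ¬∃ y, code y < code x ∧ T (code y) ≠ 0 ∧ Meets x y)
include hT

/-- The packing is maximal: a bad triple either is selected or shares a vertex with a selected one.
-/
theorem not_isBadTriple_of_notMem_selected (a : Fin n) (ha : a ∉ selected T) (b : Fin n)
    (hb : b ∉ selected T) (c : Fin n) (hc : c ∉ selected T) : ¬IsBadTriple G a b c := by
  intro hbad
  by_cases h : T (code (a, b, c)) ≠ 0
  · exact ha (mem_selected.2 ⟨_, h, Or.inl rfl⟩)
  · rw [hT, not_and_not_right] at h
    obtain ⟨y, -, hy, hm⟩ := h hbad
    rcases hm with (hm | hm) | hm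
    · exact ha (mem_selected.2 ⟨y, hy, hm⟩)
    · exact hb (mem_selected.2 ⟨y, hy, hm⟩)
    · exact hc (mem_selected.2 ⟨y, hy, hm⟩)

theorem card_selected_le : #(selected T : Finset (Fin n)) ≤ 3 * distToCocluster G := by
  classical
  obtain ⟨U, hU, hq⟩ := exists_modulator_card_eq_distToCocluster G
  rw [← hq]
  refine card_packing_le hU (univ.filter fun x => T (code x) ≠ 0)
    (fun x hx => ((hT x).1 (mem_filter.1 hx).2).1) (fun x hx y hy hxy => ?_) fun v hv => ?_
  · have hx' := (mem_filter.1 hx).2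
    have hy' := (mem_filter.1 hy).2
    have hm : ¬Meets x y := by
      intro hm
      rcases lt_trichotomy (code x) (code y) with h | h | h
      · exact ((hT y).1 hy').2 ⟨x, h, hx', hm.symm⟩
      · exact hxy (code_injective h)
      · exact ((hT x).1 hx').2 ⟨y, h, hy', hm⟩
    rw [disjoint_left]
    intro v hvx hvy
    simp only [mem_insert, mem_singleton] at hvx hvy
    unfold Meets at hm
    grind
  · obtain ⟨x, hx, h⟩ := mem_selected.1 hv
    exact ⟨x, by simpa using hx, h⟩

end

theorem table_modT_ne_zero_iff (h0 : σ 0 = n) (h1 : σ 1 = L) (hnL : n ≤ L)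
    (hL : n * n * n ≤ L) (v : Fin n) : modT.table 3 σ A v ≠ 0 ↔ v ∈ selected (A 2) := by
  rw [table]
  refine holds_modT.trans ?_
  simp only [Function.update_self, ne_eq, OfNat.zero_ne_ofNat, not_false_eq_true,
    Function.update_of_ne, OfNat.one_ne_ofNat, h0, h1, exists_lt_and_iff hnL, tripleN_eq hL,
    Fin.val_inj, Nat.reduceEqDiff, mem_selected]
  constructor
  · rintro ⟨a, b, c, h⟩
    exact ⟨(a, b, c), h⟩
  · rintro ⟨⟨a, b, c⟩, h⟩
    exact ⟨a, b, c, h⟩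

/-- The number of elements of `U` below `i`. -/
def rank (U : Finset (Fin n)) (i : ℕ) : ℕ := #(U.filter fun v : Fin n => (v : ℕ) < i)

theorem table_rankT (h0 : σ 0 = n) (h1 : σ 1 = L) (hnL : n ≤ L) {U : Finset (Fin n)}
    (hU : ∀ v : Fin n, A 3 v ≠ 0 ↔ v ∈ U) (i : ℕ) :
    rankT.table 4 σ A i = rank U i := by
  classical
  rw [table, eval_rankT]
  simp only [Function.update_self, ne_eq, OfNat.zero_ne_ofNat, not_false_eq_true,
    Function.update_of_ne, OfNat.one_ne_ofNat, h0, h1, Nat.reduceEqDiff]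
  rw [sumN_eq hnL, ← card_eq_sum_ones, rank]
  refine congrArg card ?_
  ext v
  simp only [mem_filter, mem_univ, true_and, ← hU, ne_eq]
  tauto

theorem table_powT (i : ℕ) : powT.table 5 σ A i = 2 ^ i := by
  have h : ∀ (τ : ℕ → ℕ) (A : ℕ → ℕ → ℕ), powT.eval τ A =
    if τ 3 ≠ 0 then A 5 (τ 3 - 1) + A 5 (τ 3 - 1) else 1 := fun _ _ => rfl
  induction i with
  | zero => rw [table, h]; simp
  | succ i ih =>
    rw [table, h]
    simp [ih]
    ring

theorem card_filter_lt_lt {U : Finset (Fin n)} {v : Fin n} (hv : v ∈ U) {i : ℕ} (hvi : v < i) :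
    rank U v < rank U i := by
  refine card_lt_card ⟨fun u hu => ?_, fun h => ?_⟩
  · rw [mem_filter] at hu ⊢
    exact ⟨hu.1, hu.2.trans hvi⟩
  · exact lt_irrefl _ (mem_filter.1 (h (mem_filter.2 ⟨hv, hvi⟩))).2

end

/-! ### Assembling the program and its running time -/

/-- The vertex count, the loop bound, the number of masks and the arrays of a memory. -/
def Snapshot (n L M : ℕ) (A : ℕ → ℕ → ℕ) (s : Mem) : Prop :=
  s.reg 0 = n ∧ s.reg 1 = L ∧ s.reg 2 = M ∧ s.arr = A

section

variable {n L M : ℕ} {A : ℕ → ℕ → ℕ} {s : Mem} {e : Tm} {T : ℕ}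

theorem Snapshot.assign_one (h : Snapshot n L M A s) (he : e.WF 50) {v : ℕ}
    (hv : ∀ σ : ℕ → ℕ, σ 0 = n → σ 1 = L → σ 2 = M → e.eval σ A = v) (hT : e.cost L + 1 ≤ T) :
    Runs (assign 50 1 e) s T (Snapshot n v M A) := by
  obtain ⟨h0, h1, h2, hA⟩ := h
  refine (assign_spec e (by decide) he s h1).mono hT fun s' ⟨ha, hr, hx⟩ => ⟨?_, ?_, ?_, ?_⟩
  · rw [hx 0 (by decide) (by decide), h0]
  · rw [hr, hA, hv _ h0 h1 h2]
  · rw [hx 2 (by decide) (by decide), h2]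
  · rw [ha, hA]

theorem Snapshot.assign_two (h : Snapshot n L M A s) (he : e.WF 50) {v : ℕ}
    (hv : ∀ σ : ℕ → ℕ, σ 0 = n → σ 1 = L → σ 2 = M → e.eval σ A = v) (hT : e.cost L + 1 ≤ T) :
    Runs (assign 50 2 e) s T (Snapshot n L v A) := by
  obtain ⟨h0, h1, h2, hA⟩ := h
  refine (assign_spec e (by decide) he s h1).mono hT fun s' ⟨ha, hr, hx⟩ => ⟨?_, ?_, ?_, ?_⟩
  · rw [hx 0 (by decide) (by decide), h0]
  · rw [hx 1 (by decide) (by decide), h1]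
  · rw [hr, hA, hv _ h0 h1 h2]
  · rw [ha, hA]

theorem Snapshot.fill (h : Snapshot n L M A s) (he : e.WF 50) (a : ℕ)
    (hT : (Tm.sum 3 e).cost L + 1 ≤ T) :
    Runs (fill 50 a e) s T fun s' => ∃ σ : ℕ → ℕ, σ 0 = n ∧ σ 1 = L ∧ σ 2 = M ∧
      Snapshot n L M (Function.update A a fun j => if j < L then e.table a σ A j else A a j) s' := by
  obtain ⟨h0, h1, h2, rfl⟩ := h
  refine (fill_spec e (by decide) a he s h1).mono (by omega) fun s' ⟨ha, hr⟩ =>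
    ⟨s.reg, h0, h1, h2, ?_, ?_, ?_, ha⟩
  · rw [hr 0 (by decide) (by decide), h0]
  · rw [hr 1 (by decide) (by decide), h1]
  · rw [hr 2 (by decide) (by decide), h2]

end

/-- Square the loop bound. -/
def squareT : Tm := .sum 10 (var 1)

theorem eval_squareT (σ : ℕ → ℕ) (A : ℕ → ℕ → ℕ) : squareT.eval σ A = σ 1 * σ 1 := by
  simp [squareT, eval]

def firstBoundT : Tm := add (var 0) (const 2)

/-- Cell `n` of the rank table counts the whole modulator, so this reads `2 ^ #U`. -/
def masksT : Tm := read 5 (read 4 (var 0))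

def secondBoundT : Tm := add (add (var 2) (var 0)) (const 2)

/-- The algorithm for `k`-in-a-tree. -/
def inducedTreeProg : Prog :=
  .seq (assign 50 1 firstBoundT) <| .seq (assign 50 1 squareT) <| .seq (assign 50 1 squareT) <|
  .seq (fill 50 2 selT) <| .seq (fill 50 3 modT) <| .seq (fill 50 4 rankT) <|
  .seq (fill 50 5 powT) <| .seq (assign 50 2 masksT) <| .seq (assign 50 1 secondBoundT) <|
  .seq (assign 50 1 squareT) <| .seq (assign 50 1 squareT) <| .seq (assign 50 1 squareT) <|
  .seq (fill 50 6 growT) <| assign 50 0 acceptT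

/-- One constant serves all stages; the extra step pays for the final copy of an assignment. -/
theorem exists_cost_le_of_mem (l : List Tm) :
    ∃ c, ∀ e ∈ l, ∀ L W, L + 1 ≤ W → e.cost L + 1 ≤ c * W ^ c := by
  induction l with
  | nil => exact ⟨0, by simp⟩
  | cons e l ih =>
    obtain ⟨c, hc⟩ := exists_cost_le e
    obtain ⟨d, hd⟩ := ih
    refine ⟨c + d + 1, fun e' he' L W hLW => ?_⟩
    have hW : 1 ≤ W := by omega
    have h1 : 1 ≤ W ^ (c + d + 1) := Nat.one_le_pow _ _ hW
    rcases List.mem_cons.1 he' with rfl | he'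
    · have := calc e'.cost L ≤ c * (L + 1) ^ c := hc L
        _ ≤ c * W ^ (c + d + 1) := Nat.mul_le_mul_left _
          ((Nat.pow_le_pow_left hLW c).trans (Nat.pow_le_pow_right hW (by omega)))
      calc e'.cost L + 1 ≤ c * W ^ (c + d + 1) + 1 * W ^ (c + d + 1) := by omega
        _ = (c + 1) * W ^ (c + d + 1) := by ring
        _ ≤ _ := Nat.mul_le_mul_right _ (by omega)
    · calc e'.cost L + 1 ≤ d * W ^ d := hd e' he' L W hLW
        _ ≤ _ := Nat.mul_le_mul (by omega) (Nat.pow_le_pow_right hW (by omega))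

theorem instanceMem_adj {n : ℕ} (G : SimpleGraph (Fin n)) (K : Finset (Fin n)) (i j : Fin n) :
    (instanceMem G K).arr 0 (i * n + j) ≠ 0 ↔ G.Adj i j := by
  simp only [instanceMem, if_true]
  constructor
  · intro h
    split_ifs at h with hh
    · obtain ⟨i', j', he, hadj⟩ := hh
      obtain ⟨hi, hj⟩ := mul_add_inj j.2 j'.2 he
      rwa [Fin.ext hi, Fin.ext hj]
    · exact absurd rfl h
  · intro h
    rw [if_pos ⟨i, j, rfl, h⟩]
    exact one_ne_zero

theorem instanceMem_term {n : ℕ} (G : SimpleGraph (Fin n)) (K : Finset (Fin n)) (i : Fin n) :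
    (instanceMem G K).arr 1 i ≠ 0 ↔ i ∈ K := by
  simp [instanceMem, Fin.val_inj]

theorem instanceMem_eq_zero {n : ℕ} (G : SimpleGraph (Fin n)) (K : Finset (Fin n)) {a : ℕ}
    (ha : 2 ≤ a) : (instanceMem G K).arr a = 0 := by
  funext j
  simp [instanceMem, show a ≠ 0 by omega, show a ≠ 1 by omega]

theorem inducedTreeProg_spec {n c W : ℕ} (G : SimpleGraph (Fin n)) (K : Finset (Fin n))
    (hc : ∀ e ∈ [firstBoundT, squareT, .sum 3 selT, .sum 3 modT, .sum 3 rankT, .sum 3 powT, masksT,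
      secondBoundT, .sum 3 growT, acceptT], ∀ L, L + 1 ≤ W → e.cost L + 1 ≤ c * W ^ c)
    (hW : (2 ^ (3 * distToCocluster G) + n + 2) ^ 8 + 1 ≤ W) :
    Runs inducedTreeProg (instanceMem G K) (14 * (c * W ^ c)) fun s =>
      s.reg 0 ≠ 0 ↔ HasInducedTreeContaining G K := by
  set A₀ := (instanceMem G K).arr with hA₀
  simp only [List.forall_mem_cons, List.not_mem_nil, false_imp_iff, implies_true, and_true] at hc
  obtain ⟨c1, c2, c3, c4, c5, c6, c7, c8, c9, c10⟩ := hc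
  set N := 2 ^ (3 * distToCocluster G) + n + 2 with hN
  have hQ : 1 ≤ 2 ^ (3 * distToCocluster G) := Nat.one_le_two_pow
  have hpow : ∀ k ≤ 8, N ^ k + 1 ≤ W := fun k hk =>
    (Nat.succ_le_succ (Nat.pow_le_pow_right (by omega) hk)).trans hW
  have hpow' : ∀ L, L ≤ N → ∀ k ≤ 8, L ^ k + 1 ≤ W := fun L hL k hk =>
    (Nat.succ_le_succ (Nat.pow_le_pow_left hL k)).trans (hpow k hk)
  have hn2 : n + 2 ≤ N := by omega
  have hb : ∀ L, L ≤ N → L + 1 ≤ W := fun L hL => by simpa using hpow' L hL 1 (by decide)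
  have start : Snapshot n 0 0 A₀ (instanceMem G K) := ⟨rfl, rfl, rfl, rfl⟩
  set L₁ := (n + 2) * (n + 2) * ((n + 2) * (n + 2)) with hL₁
  have hL₁' : L₁ = (n + 2) ^ 4 := by rw [hL₁]; ring
  have hL₁W : L₁ + 1 ≤ W := hL₁' ▸ hpow' _ hn2 4 (by decide)
  -- Strictness matters: cell `n` of the rank table, which holds `#U`, must be filled.
  have hnL₁ : n < L₁ := hL₁' ▸ (by omega : n < n + 2).trans_le (Nat.le_self_pow (by decide) _)
  have hcube : n * n * n ≤ L₁ := by
    rw [hL₁, mul_assoc]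
    exact Nat.mul_le_mul ((Nat.le_mul_of_pos_right _ (by omega)).trans
      (Nat.mul_le_mul_right _ (by omega))) (Nat.mul_le_mul (by omega) (by omega))
  -- Register `1` is still zero here, which is harmless because `firstBoundT` contains no sum.
  refine (Runs.seq (T' := 13 * (c * W ^ c)) (start.assign_one (e := firstBoundT) (v := n + 2) (by decide)
    (fun σ h0 h1 h2 => show σ 0 + 2 = n + 2 by rw [h0]) (c1 0 (hb 0 (by omega))))
    fun s₁ hs₁ => ?_).mono (by omega) fun _ h => h
  refine (Runs.seq (T' := 12 * (c * W ^ c)) (hs₁.assign_one (e := squareT) (v := (n + 2) * (n + 2)) (by decide)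
    (fun σ h0 h1 h2 => (eval_squareT σ _).trans (by rw [h1])) (c2 _ (hb _ hn2)))
    fun s₂ hs₂ => ?_).mono (by omega) fun _ h => h
  refine (Runs.seq (T' := 11 * (c * W ^ c)) (hs₂.assign_one (e := squareT) (v := L₁) (by decide)
    (fun σ h0 h1 h2 => (eval_squareT σ _).trans (by rw [h1]))
    (c2 _ (by rw [← pow_two]; exact hpow' _ hn2 2 (by decide))))
    fun s₃ hs₃ => ?_).mono (by omega) fun _ h => h
  refine (Runs.seq (T' := 10 * (c * W ^ c)) (hs₃.fill wf_selT 2 (c3 _ hL₁W))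
    fun s₄ ⟨σ₂, h0, h1, h2, hs₄⟩ => ?_).mono (by omega) fun _ h => h
  have hT₂ := table_selT_ne_zero_iff h0 h1 hnL₁.le hcube (instanceMem_adj G K)
    (instanceMem_eq_zero G K le_rfl)
  rw [← hA₀] at hT₂
  set A₁ := Function.update A₀ 2 fun j => if j < L₁ then selT.table 2 σ₂ A₀ j else A₀ 2 j with hA₁
  have hT₂' : ∀ x : Fin n × Fin n × Fin n, A₁ 2 (code x) ≠ 0 ↔ IsBadTriple G x.1 x.2.1 x.2.2 ∧
      ¬∃ y, code y < code x ∧ A₁ 2 (code y) ≠ 0 ∧ Meets x y := by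
    have : ∀ x : Fin n × Fin n × Fin n, A₁ 2 (code x) = selT.table 2 σ₂ A₀ (code x) := fun x => by
      simp [hA₁, code_lt hcube x]
    simpa only [this] using hT₂
  set U : Finset (Fin n) := selected (A₁ 2) with hU
  have hUq : #U ≤ 3 * distToCocluster G := card_selected_le hT₂'
  refine (Runs.seq (T' := 9 * (c * W ^ c)) (hs₄.fill wf_modT 3 (c4 _ hL₁W))
    fun s₅ ⟨σ₃, h0, h1, h2, hs₅⟩ => ?_).mono (by omega) fun _ h => h
  have hT₃ := table_modT_ne_zero_iff (A := A₁) h0 h1 hnL₁.le hcube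
  set A₂ := Function.update A₁ 3 fun j => if j < L₁ then modT.table 3 σ₃ A₁ j else A₁ 3 j with hA₂
  have hT₃' : ∀ v : Fin n, A₂ 3 v ≠ 0 ↔ v ∈ U := fun v => by
    rw [← hT₃ v]; simp [hA₂, v.2.trans hnL₁]
  refine (Runs.seq (T' := 8 * (c * W ^ c)) (hs₅.fill wf_rankT 4 (c5 _ hL₁W))
    fun s₆ ⟨σ₄, h0, h1, h2, hs₆⟩ => ?_).mono (by omega) fun _ h => h
  have hT₄ := table_rankT h0 h1 hnL₁.le hT₃'
  set A₃ := Function.update A₂ 4 fun j => if j < L₁ then rankT.table 4 σ₄ A₂ j else A₂ 4 j with hA₃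
  have hT₄' : ∀ i < L₁, A₃ 4 i = rank U i := fun i hi => by
    rw [← hT₄ i]; simp [hA₃, hi]
  refine (Runs.seq (T' := 7 * (c * W ^ c)) (hs₆.fill wf_powT 5 (c6 _ hL₁W))
    fun s₇ ⟨σ₅, h0, h1, h2, hs₇⟩ => ?_).mono (by omega) fun _ h => h
  set A₄ := Function.update A₃ 5 fun j => if j < L₁ then powT.table 5 σ₅ A₃ j else A₃ 5 j with hA₄
  have hT₅' : ∀ i < L₁, A₄ 5 i = 2 ^ i := fun i hi => by
    rw [← table_powT (σ := σ₅) (A := A₃) i]; simp [hA₄, hi]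
  have hrank : ∀ i < L₁, A₄ 4 i = rank U i := fun i hi => by
    rw [← hT₄' i hi]; simp [hA₄]
  have hm : A₄ 4 n = #U := by
    rw [hrank n hnL₁, rank, filter_true_of_mem fun v _ => v.2]
  have hUn : #U < L₁ := (by simpa using card_le_univ U : #U ≤ n).trans_lt hnL₁
  set M := 2 ^ #U with hM
  have hMN : M + n + 2 ≤ N := by
    have : M ≤ 2 ^ (3 * distToCocluster G) := Nat.pow_le_pow_right (by decide) hUq
    omega
  refine (Runs.seq (T' := 6 * (c * W ^ c)) (hs₇.assign_two (e := masksT) (v := M) (by decide)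
    (fun σ h0 h1 h2 => show A₄ 5 (A₄ 4 (σ 0)) = M by rw [h0, hm, hT₅' _ hUn]) (c7 _ hL₁W))
    fun s₈ hs₈ => ?_).mono (by omega) fun _ h => h
  refine (Runs.seq (T' := 5 * (c * W ^ c)) (hs₈.assign_one (e := secondBoundT) (v := M + n + 2) (by decide)
    (fun σ h0 h1 h2 => show σ 2 + σ 0 + 2 = M + n + 2 by rw [h0, h2]) (c8 _ hL₁W))
    fun s₉ hs₉ => ?_).mono (by omega) fun _ h => h
  refine (Runs.seq (T' := 4 * (c * W ^ c)) (hs₉.assign_one (e := squareT) (v := (M + n + 2) ^ 2) (by decide)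
    (fun σ h0 h1 h2 => (eval_squareT σ _).trans (by rw [h1]; ring)) (c2 _ (hb _ hMN)))
    fun s₁₀ hs₁₀ => ?_).mono (by omega) fun _ h => h
  refine (Runs.seq (T' := 3 * (c * W ^ c)) (hs₁₀.assign_one (e := squareT) (v := (M + n + 2) ^ 4) (by decide)
    (fun σ h0 h1 h2 => (eval_squareT σ _).trans (by rw [h1]; ring))
    (c2 _ (hpow' _ hMN 2 (by decide))))
    fun s₁₁ hs₁₁ => ?_).mono (by omega) fun _ h => h
  refine (Runs.seq (T' := 2 * (c * W ^ c)) (hs₁₁.assign_one (e := squareT) (v := (M + n + 2) ^ 8) (by decide)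
    (fun σ h0 h1 h2 => (eval_squareT σ _).trans (by rw [h1]; ring))
    (c2 _ (hpow' _ hMN 4 (by decide))))
    fun s₁₂ hs₁₂ => ?_).mono (by omega) fun _ h => h
  have hL₂W := hpow' _ hMN 8 le_rfl
  set L₂ := (M + n + 2) ^ 8 with hL₂
  refine (Runs.seq (T' := c * W ^ c) (hs₁₂.fill wf_growT 6 (c9 _ hL₂W))
    fun s₁₃ ⟨σ₆, h0, h1, h2, hs₁₃⟩ => ?_).mono (by omega) fun _ h => h
  have hsetup : Setup G K U A₄ L₂ #U := {
    n_le := (by omega : n ≤ M + n + 2).trans (Nat.le_self_pow (by decide) _)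
    adj := by simpa [hA₁, hA₂, hA₃, hA₄] using instanceMem_adj G K
    term := by simpa [hA₁, hA₂, hA₃, hA₄] using instanceMem_term G K
    mod := fun v => by rw [← hT₃' v]; simp [hA₃, hA₄]
    rank_lt := fun v hv => by
      rw [hrank v (v.2.trans hnL₁), ← hm, hrank n hnL₁]
      exact card_filter_lt_lt hv v.2
    rank_inj := fun v hv w hw hvw => by
      rw [hrank v (v.2.trans hnL₁), hrank w (w.2.trans hnL₁)] at hvw
      rcases lt_trichotomy v w with h | h | h
      · exact absurd hvw (card_filter_lt_lt hv h).ne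
      · exact h
      · exact absurd hvw (card_filter_lt_lt hw h).ne'
    pow := fun i hi => hT₅' i (by omega)
    -- Five factors are needed; three squarings of `M + n + 2` provide eight.
    size := by
      rw [← hM, hL₂]
      have e1 : M ≤ M + n + 2 := by omega
      have e2 : n ≤ M + n + 2 := by omega
      calc M * n * n * n * M ≤ (M + n + 2) * (M + n + 2) * (M + n + 2) * (M + n + 2) *
            (M + n + 2) := by gcongr
        _ = (M + n + 2) ^ 5 := by ring
        _ ≤ _ := Nat.pow_le_pow_right (by omega) (by decide) }
  have hA₆ : A₄ 6 = 0 := by simpa [hA₁, hA₂, hA₃, hA₄] using instanceMem_eq_zero G K (by decide)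
  obtain ⟨g0, g1, g2, g3⟩ := hs₁₃
  refine (assign_spec acceptT (by decide) wf_acceptT s₁₃ g1).mono (c10 _ hL₂W)
    fun s₁₄ ⟨_, hr, _⟩ => ?_
  rw [hr, g3]
  exact holds_acceptT_iff hsetup h0 h1 h2 hA₆ (not_isBadTriple_of_notMem_selected hT₂') g0 g1 g2

end RAM

/-- One program decides `k`-in-a-tree, given only `(G, K)`, in time `2^{O(q)} n^{O(1)}`, where `q` is
the distance to co-cluster of `G` and `n` is its number of vertices. Register `0` holds the answer
(nonzero for yes). The base `n + 1` instead of `n` only matters for the graph without vertices. -/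
theorem mainTheorem7 :
    ∃ (p : RAM.Prog) (c : ℕ), ∀ (n : ℕ) (G : SimpleGraph (Fin n)) (K : Finset (Fin n)),
      ∃ (t : ℕ) (s : RAM.Mem), RAM.Exec p (RAM.instanceMem G K) t s ∧
        (s.reg 0 ≠ 0 ↔ HasInducedTreeContaining G K) ∧
        t ≤ c * 2 ^ (c * distToCocluster G) * (n + 1) ^ c := by
  obtain ⟨c, hc⟩ := RAM.exists_cost_le_of_mem [RAM.firstBoundT, RAM.squareT, .sum 3 RAM.Tm.selT,
    .sum 3 RAM.Tm.modT, .sum 3 RAM.Tm.rankT, .sum 3 RAM.Tm.powT, RAM.masksT, RAM.secondBoundT,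
    .sum 3 RAM.Tm.growT, RAM.Tm.acceptT]
  -- There are `14` stages, each within `c * W ^ c` for `W = (4 * Q * (n + 1)) ^ 8` and `Q = 2 ^ (3
  -- * q)`. The first summand covers the constant factor, and `24 * c` the exponent coming from `Q ^
  -- (8 * c)`.
  refine ⟨RAM.inducedTreeProg, 14 * c * 4 ^ (8 * c) + 24 * c, fun n G K => ?_⟩
  set q := distToCocluster G
  set Q := 2 ^ (3 * q) with hQ
  have hQ1 : 1 ≤ Q := Nat.one_le_two_pow
  have h1 : Q + n + 2 ≤ 3 * Q * (n + 1) := by nlinarith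
  have h2 : (3 * Q * (n + 1)) ^ 8 + 1 ≤ (4 * Q * (n + 1)) ^ 8 := by
    refine Nat.pow_lt_pow_left ?_ (by decide)
    nlinarith
  obtain ⟨t, s, h, ht, hs⟩ := RAM.inducedTreeProg_spec G K
    (fun e he L hL => hc e he L ((4 * Q * (n + 1)) ^ 8) hL)
    ((Nat.succ_le_succ (Nat.pow_le_pow_left h1 8)).trans h2)
  refine ⟨t, s, h, hs, ht.trans ?_⟩
  have e1 : (2 : ℕ) ^ (24 * c * q) ≤ 2 ^ ((14 * c * 4 ^ (8 * c) + 24 * c) * q) :=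
    Nat.pow_le_pow_right (by decide) (Nat.mul_le_mul_right _ (by omega))
  have e2 : (n + 1) ^ (8 * c) ≤ (n + 1) ^ (14 * c * 4 ^ (8 * c) + 24 * c) :=
    Nat.pow_le_pow_right (by omega) (by omega)
  calc 14 * (c * ((4 * Q * (n + 1)) ^ 8) ^ c)
      = 14 * c * 4 ^ (8 * c) * 2 ^ (24 * c * q) * (n + 1) ^ (8 * c) := by
        have : Q ^ (8 * c) = 2 ^ (24 * c * q) := by
          rw [hQ, ← pow_mul]; congr 1; ring
        rw [← this, ← pow_mul, mul_pow, mul_pow]; ring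
    _ ≤ _ := Nat.mul_le_mul (Nat.mul_le_mul (by omega) e1) e2
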